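/- Let $k$ be an algebraically closed field. Let $H$ and $H'$ be finite-dimensional Hopf algebras over $k$ which are not semisimple and which are basic, i.e. the quotient of each by its Jacobson radical is isomorphic, as a $k$-algebra, to a finite product of copies of $k$. Let $H\text{-}\mathsf{mod}$ and $H'\text{-}\mathsf{mod}$ be their categories of finite-dimensional modules, with tensor product $\otimes_k$ (on which $H$, resp. $H'$, acts through the comultiplication) and unit object $k$ (on which it acts through the counit). For a $k$-linear abelian category $\mathcal C$, the stable category $\underline{\mathcal C}$ has the same objects as $\mathcal C$, and its morphisms $X\to Y$ are the morphisms of $\mathcal C$ modulo the subspace of those which factor through a projective object. Let $F: H\text{-}\mathsf{mod}\to H'\text{-}\mathsf{mod}$ be an exact $k$-linear (strong) monoidal functor which induces a stable equivalence, i.e. $F$ maps projective objects to projective objects and the induced functor $\underline F: H\text{-}\underline{\mathsf{mod}}\to H'\text{-}\underline{\mathsf{mod}}$, $X\mapsto F(X)$, $\underline f\mapsto \underline{F(f)}$, is an equivalence of categories. Then $H$ and $H'$ are gauge equivalent: there are an invertible element $J\in H\otimes_k H$ with $$(\varepsilon\otimes\mathrm{id})(J)=1=(\mathrm{id}\otimes\varepsilon)(J),\qquad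 (1\otimes J)\,(\mathrm{id}\otimes\Delta)(J)=(J\otimes 1)\,(\Delta\otimes\mathrm{id})(J),$$ and an isomorphism of $k$-algebras $\sigma: H\to H'$ such that $\varepsilon_{H'}(\sigma(h))=\varepsilon_H(h)$ and $\Delta_{H'}(\sigma(h))=(\sigma\otimes\sigma)\bigl(J\,\Delta_H(h)\,J^{-1}\bigr)$ for all $h\in H$. -/

import Mathlib

open CategoryTheory TensorProduct

universe u v

noncomputable section

/-! ## Finite-dimensional modules over an algebra -/

/-- A finite-dimensional module over the `k`-algebra `H`: a finite-dimensional `k`-vector space `V`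
together with an action `ρ : H → End_k V`. For finite-dimensional `H` these are exactly the
finitely generated `H`-modules. -/
structure FinMod (k H : Type u) [Field k] [Ring H] [Algebra k H] : Type (u + 1) where
  /-- the underlying vector space -/
  V : Type u
  [addCommGroup : AddCommGroup V]
  [module : Module k V]
  [finite : FiniteDimensional k V]
  /-- the action of `H` -/
  ρ : H →ₐ[k] Module.End k V

namespace FinMod

attribute [instance] FinMod.addCommGroup FinMod.module FinMod.finite

section Algebra

variable {k H : Type u} [Field k] [Ring H] [Algebra k H]

/-- The space of `H`-linear maps, as a subspace of the space of `k`-linear maps. -/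
def intertwiners (X Y : FinMod k H) : Submodule k (X.V →ₗ[k] Y.V) where
  carrier := {f | ∀ h : H, f ∘ₗ X.ρ h = Y.ρ h ∘ₗ f}
  add_mem' hf hg h := by rw [LinearMap.add_comp, LinearMap.comp_add, hf h, hg h]
  zero_mem' h := by rw [LinearMap.zero_comp, LinearMap.comp_zero]
  smul_mem' c f hf h := by rw [LinearMap.smul_comp, LinearMap.comp_smul, hf h]

theorem mem_intertwiners {X Y : FinMod k H} {f : X.V →ₗ[k] Y.V} :
    f ∈ intertwiners X Y ↔ ∀ h : H, f ∘ₗ X.ρ h = Y.ρ h ∘ₗ f := Iff.rfl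

/-- A morphism of modules is an `H`-linear map. -/
@[ext]
structure Hom (X Y : FinMod k H) : Type u where
  /-- the underlying `k`-linear map -/
  lin : X.V →ₗ[k] Y.V
  mem : lin ∈ intertwiners X Y

instance category : Category.{u} (FinMod k H) where
  Hom := Hom
  id X := ⟨LinearMap.id, fun _ => rfl⟩
  comp f g := ⟨g.lin ∘ₗ f.lin, fun h => by
    rw [LinearMap.comp_assoc, f.mem h, ← LinearMap.comp_assoc, g.mem h, LinearMap.comp_assoc]⟩

@[ext]
theorem hom_ext {X Y : FinMod k H} {f g : X ⟶ Y} (h : f.lin = g.lin) : f = g := Hom.ext h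

@[simp] theorem id_lin (X : FinMod k H) : Hom.lin (𝟙 X) = LinearMap.id := rfl

@[simp] theorem comp_lin {X Y Z : FinMod k H} (f : X ⟶ Y) (g : Y ⟶ Z) :
    (f ≫ g).lin = g.lin ∘ₗ f.lin := rfl

/-- Morphisms are the elements of the space of `H`-linear maps. -/
def homEquiv (X Y : FinMod k H) : (X ⟶ Y) ≃ intertwiners X Y where
  toFun f := ⟨f.lin, f.mem⟩
  invFun f := ⟨f.1, f.2⟩
  left_inv _ := rfl
  right_inv _ := rfl

instance homAddCommGroup (X Y : FinMod k H) : AddCommGroup (X ⟶ Y) :=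
  (homEquiv X Y).addCommGroup

instance homModule (X Y : FinMod k H) : Module k (X ⟶ Y) :=
  (homEquiv X Y).module k

@[simp] theorem add_lin {X Y : FinMod k H} (f g : X ⟶ Y) : (f + g).lin = f.lin + g.lin := rfl

@[simp] theorem zero_lin (X Y : FinMod k H) : (0 : X ⟶ Y).lin = 0 := rfl

@[simp] theorem smul_lin {X Y : FinMod k H} (c : k) (f : X ⟶ Y) : (c • f).lin = c • f.lin := rfl

instance preadditive : Preadditive (FinMod k H) where
  add_comp _ _ _ f f' g := hom_ext (by simp [LinearMap.comp_add])
  comp_add _ _ _ f g g' := hom_ext (by simp [LinearMap.add_comp])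

instance linear : Linear k (FinMod k H) where
  homModule := homModule
  smul_comp _ _ _ c f g := hom_ext (by simp [LinearMap.comp_smul])
  comp_smul _ _ _ f c g := hom_ext (by simp [LinearMap.smul_comp])

/-- An `H`-linear bijection is an isomorphism of modules. -/
def mkIso {X Y : FinMod k H} (e : X.V ≃ₗ[k] Y.V) (he : e.toLinearMap ∈ intertwiners X Y) :
    X ≅ Y where
  hom := ⟨e, he⟩
  inv := ⟨e.symm, fun h => LinearMap.ext fun y => e.injective (by
    have := LinearMap.congr_fun (he h) (e.symm y)
    simpa using this.symm)⟩
  hom_inv_id := hom_ext (LinearMap.ext e.symm_apply_apply)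
  inv_hom_id := hom_ext (LinearMap.ext e.apply_symm_apply)

/-- The forgetful functor to vector spaces. -/
def forget (k H : Type u) [Field k] [Ring H] [Algebra k H] : FinMod k H ⥤ ModuleCat.{u} k where
  obj X := ModuleCat.of k X.V
  map f := ModuleCat.ofHom f.lin

instance : (forget k H).Faithful where
  map_injective h := hom_ext (ModuleCat.hom_ext_iff.1 h)

/-- The direct sum of two modules. -/
def directSum (X Y : FinMod k H) : FinMod k H where
  V := X.V × Y.V
  ρ := AlgHom.ofLinearMap
    { toFun := fun h => (X.ρ h).prodMap (Y.ρ h)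
      map_add' := fun a b => by rw [map_add, map_add]; rfl
      map_smul' := fun c a => by rw [map_smul, map_smul]; rfl }
    (by simp) (fun a b => by simp; rfl)

instance hasBinaryBiproducts : Limits.HasBinaryBiproducts (FinMod k H) where
  has_binary_biproduct X Y := Limits.hasBinaryBiproduct_of_total
    { pt := directSum X Y
      fst := ⟨LinearMap.fst k X.V Y.V, fun _ => rfl⟩
      snd := ⟨LinearMap.snd k X.V Y.V, fun _ => rfl⟩
      inl := ⟨LinearMap.inl k X.V Y.V, fun h => LinearMap.ext fun _ =>
        Prod.ext rfl (map_zero (Y.ρ h)).symm⟩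
      inr := ⟨LinearMap.inr k X.V Y.V, fun h => LinearMap.ext fun _ =>
        Prod.ext (map_zero (X.ρ h)).symm rfl⟩
      inl_fst := hom_ext rfl
      inl_snd := hom_ext rfl
      inr_fst := hom_ext rfl
      inr_snd := hom_ext rfl }
    (hom_ext (LinearMap.ext fun p => Prod.ext (add_zero p.1) (zero_add p.2)))

/-- The zero module. -/
def zeroModule (k H : Type u) [Field k] [Ring H] [Algebra k H] : FinMod k H where
  V := PUnit
  ρ := AlgHom.ofLinearMap 0 (Subsingleton.elim _ _) fun _ _ => Subsingleton.elim _ _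

instance hasZeroObject : Limits.HasZeroObject (FinMod k H) where
  zero := ⟨zeroModule k H, (Limits.IsZero.iff_id_eq_zero _).2
    (hom_ext (LinearMap.ext fun _ => Subsingleton.elim (α := PUnit) _ _))⟩

end Algebra

/-! ## The monoidal structure on the modules over a bialgebra -/

section Bialgebra

variable {k H : Type u} [Field k] [Ring H] [Bialgebra k H]

/-- The action of `H ⊗ H` on `V ⊗ W`: `(a ⊗ b) (v ⊗ w) = a v ⊗ b w`. -/
def pairAction (X Y : FinMod k H) : H ⊗[k] H →ₐ[k] Module.End k (X.V ⊗[k] Y.V) :=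
  (Module.endTensorEndAlgHom (R := k) (S := k) (A := k) (M := X.V) (N := Y.V)).comp
    (Algebra.TensorProduct.map X.ρ Y.ρ)

@[simp] theorem pairAction_tmul (X Y : FinMod k H) (a b : H) (x : X.V) (y : Y.V) :
    pairAction X Y (a ⊗ₜ b) (x ⊗ₜ y) = X.ρ a x ⊗ₜ Y.ρ b y := rfl

/-- The tensor product over `k` of two `H`-modules, with `H` acting through the comultiplication:
`h (v ⊗ w) = ∑ h₁ v ⊗ h₂ w`. -/
def tensor (X Y : FinMod k H) : FinMod k H where
  V := X.V ⊗[k] Y.V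
  ρ := (pairAction X Y).comp (Bialgebra.comulAlgHom k H)

/-- The trivial module: `k` with `H` acting through the counit. -/
def trivial (k H : Type u) [Field k] [Ring H] [Bialgebra k H] : FinMod k H where
  V := k
  ρ := (Algebra.ofId k (Module.End k k)).comp (Bialgebra.counitAlgHom k H)

theorem tensor_ρ (X Y : FinMod k H) (h : H) :
    (tensor X Y).ρ h = pairAction X Y (Coalgebra.comul h) := rfl

theorem trivial_ρ (h : H) (c : k) :
    (trivial k H).ρ h c = Coalgebra.counit (R := k) h * c := rfl

theorem map_pairAction {X X' Y Y' : FinMod k H} (f : X ⟶ X') (g : Y ⟶ Y') (t : H ⊗[k] H) :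
    TensorProduct.map f.lin g.lin ∘ₗ pairAction X Y t =
      pairAction X' Y' t ∘ₗ TensorProduct.map f.lin g.lin := by
  induction t with
  | zero => simp
  | add s t hs ht => rw [map_add, map_add, LinearMap.comp_add, LinearMap.add_comp, hs, ht]
  | tmul a b =>
    refine TensorProduct.ext' fun x y => ?_
    have h₁ := LinearMap.congr_fun (f.mem a) x
    have h₂ := LinearMap.congr_fun (g.mem b) y
    simp only [LinearMap.comp_apply] at h₁ h₂
    simp [h₁, h₂]

/-- The tensor product of two morphisms. -/
def tensorMap {X X' Y Y' : FinMod k H} (f : X ⟶ X') (g : Y ⟶ Y') : tensor X Y ⟶ tensor X' Y' :=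
  ⟨TensorProduct.map f.lin g.lin, fun _ => map_pairAction f g _⟩

/-- The action of `(H ⊗ H) ⊗ H` on `(U ⊗ V) ⊗ W`. -/
def tripleLeft (X Y Z : FinMod k H) :
    (H ⊗[k] H) ⊗[k] H →ₐ[k] Module.End k ((X.V ⊗[k] Y.V) ⊗[k] Z.V) :=
  (Module.endTensorEndAlgHom (R := k) (S := k) (A := k)).comp
    (Algebra.TensorProduct.map (pairAction X Y) Z.ρ)

/-- The action of `H ⊗ (H ⊗ H)` on `U ⊗ (V ⊗ W)`. -/
def tripleRight (X Y Z : FinMod k H) :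
    H ⊗[k] (H ⊗[k] H) →ₐ[k] Module.End k (X.V ⊗[k] (Y.V ⊗[k] Z.V)) :=
  (Module.endTensorEndAlgHom (R := k) (S := k) (A := k)).comp
    (Algebra.TensorProduct.map X.ρ (pairAction Y Z))

theorem pairAction_tensor_left (X Y Z : FinMod k H) (t : H ⊗[k] H) :
    pairAction (tensor X Y) Z t = tripleLeft X Y Z (Coalgebra.comul.rTensor H t) := by
  induction t with
  | zero => simp; rfl
  | add s t hs ht => rw [map_add, map_add, map_add, hs, ht]; rfl
  | tmul a b => rfl

theorem pairAction_tensor_right (X Y Z : FinMod k H) (t : H ⊗[k] H) :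
    pairAction X (tensor Y Z) t = tripleRight X Y Z (Coalgebra.comul.lTensor H t) := by
  induction t with
  | zero => simp; rfl
  | add s t hs ht => rw [map_add, map_add, map_add, hs, ht]; rfl
  | tmul a b => rfl

theorem assoc_triple (X Y Z : FinMod k H) (t : (H ⊗[k] H) ⊗[k] H) :
    (TensorProduct.assoc k X.V Y.V Z.V).toLinearMap ∘ₗ tripleLeft X Y Z t =
      tripleRight X Y Z (TensorProduct.assoc k H H H t) ∘ₗ
        (TensorProduct.assoc k X.V Y.V Z.V).toLinearMap := by
  induction t with
  | zero => simp
  | add s t hs ht => simp only [map_add, LinearMap.comp_add, LinearMap.add_comp, hs, ht]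
  | tmul s c =>
    induction s with
    | zero => simp
    | add s t hs ht =>
      simp only [TensorProduct.add_tmul, map_add, LinearMap.comp_add, LinearMap.add_comp, hs, ht]
    | tmul a b => exact TensorProduct.ext_threefold fun x y z => rfl

/-- The associativity constraint is that of vector spaces. -/
def associator (X Y Z : FinMod k H) : tensor (tensor X Y) Z ≅ tensor X (tensor Y Z) :=
  mkIso (TensorProduct.assoc k X.V Y.V Z.V) fun h => by
    rw [tensor_ρ, tensor_ρ, pairAction_tensor_left, pairAction_tensor_right,
      ← Coalgebra.coassoc_apply]
    exact assoc_triple X Y Z _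

theorem lid_pairAction (X : FinMod k H) (t : H ⊗[k] H) :
    (TensorProduct.lid k X.V).toLinearMap ∘ₗ pairAction (trivial k H) X t =
      X.ρ (TensorProduct.lid k H (Coalgebra.counit.rTensor H t)) ∘ₗ
        (TensorProduct.lid k X.V).toLinearMap := by
  induction t with
  | zero => simp; rfl
  | add s t hs ht =>
    simp only [map_add, LinearMap.add_comp, ← hs, ← ht]
    exact LinearMap.comp_add _ _ _
  | tmul a b =>
    refine TensorProduct.ext' fun (x : k) y => ?_
    change (Coalgebra.counit (R := k) a * x) • X.ρ b y =
      X.ρ (Coalgebra.counit (R := k) a • b) (x • y)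
    simp only [map_smul, LinearMap.smul_apply, mul_smul, smul_comm x]

theorem rid_pairAction (X : FinMod k H) (t : H ⊗[k] H) :
    (TensorProduct.rid k X.V).toLinearMap ∘ₗ pairAction X (trivial k H) t =
      X.ρ (TensorProduct.rid k H (Coalgebra.counit.lTensor H t)) ∘ₗ
        (TensorProduct.rid k X.V).toLinearMap := by
  induction t with
  | zero => simp; rfl
  | add s t hs ht =>
    simp only [map_add, LinearMap.add_comp, ← hs, ← ht]
    exact LinearMap.comp_add _ _ _
  | tmul a b =>
    refine TensorProduct.ext' fun x (y : k) => ?_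
    change (Coalgebra.counit (R := k) b * y) • X.ρ a x =
      X.ρ (Coalgebra.counit (R := k) b • a) (y • x)
    simp only [map_smul, LinearMap.smul_apply, mul_smul, smul_comm y]

/-- The left unit constraint is that of vector spaces. -/
def leftUnitor (X : FinMod k H) : tensor (trivial k H) X ≅ X :=
  mkIso (TensorProduct.lid k X.V) fun h => by
    have := lid_pairAction X (Coalgebra.comul h)
    rw [Coalgebra.rTensor_counit_comul, TensorProduct.lid_tmul, one_smul] at this
    exact this

/-- The right unit constraint is that of vector spaces. -/
def rightUnitor (X : FinMod k H) : tensor X (trivial k H) ≅ X :=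
  mkIso (TensorProduct.rid k X.V) fun h => by
    have := rid_pairAction X (Coalgebra.comul h)
    rw [Coalgebra.lTensor_counit_comul, TensorProduct.rid_tmul, one_smul] at this
    exact this

instance monoidalCategoryStruct : MonoidalCategoryStruct (FinMod k H) where
  tensorObj := tensor
  whiskerLeft X _ _ g := tensorMap (𝟙 X) g
  whiskerRight f Y := tensorMap f (𝟙 Y)
  tensorHom := tensorMap
  tensorUnit := trivial k H
  associator := associator
  leftUnitor := leftUnitor
  rightUnitor := rightUnitor

instance monoidalCategory : MonoidalCategory (FinMod k H) :=
  Monoidal.induced (forget k H)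
    { μIso := fun _ _ => Iso.refl _
      εIso := Iso.refl _
      whiskerLeft_eq := fun _ _ _ _ => rfl
      whiskerRight_eq := fun _ _ => rfl
      tensorHom_eq := fun _ _ => rfl
      associator_eq := fun _ _ _ => ModuleCat.hom_ext (TensorProduct.ext_threefold fun _ _ _ => rfl)
      leftUnitor_eq := fun _ => ModuleCat.hom_ext (TensorProduct.ext' fun _ _ => rfl)
      rightUnitor_eq := fun _ => ModuleCat.hom_ext (TensorProduct.ext' fun _ _ => rfl) }

end Bialgebra

end FinMod

/-! ## Stable categories -/

section Stable

variable {C : Type u} [Category.{v} C] [Preadditive C] [Limits.HasBinaryBiproducts C]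
  [Limits.HasZeroObject C]
variable {D : Type u} [Category.{v} D] [Preadditive D] [Limits.HasBinaryBiproducts D]
  [Limits.HasZeroObject D]

/-- The subgroup of those morphisms `X ⟶ Y` which factor through a projective object. -/
def projectiveMorphisms (X Y : C) : AddSubgroup (X ⟶ Y) where
  carrier := {f | ∃ P : C, Projective P ∧ ∃ (i : X ⟶ P) (j : P ⟶ Y), i ≫ j = f}
  add_mem' := by
    rintro f g ⟨P, hP, i, j, rfl⟩ ⟨Q, hQ, i', j', rfl⟩
    exact ⟨P ⊞ Q, inferInstance, Limits.biprod.lift i i', Limits.biprod.desc j j', by simp⟩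
  zero_mem' := by
    obtain ⟨Z, hZ⟩ := Limits.HasZeroObject.zero (C := C)
    exact ⟨Z, ⟨fun f e _ => ⟨0, hZ.eq_of_src _ _⟩⟩, 0, 0, by simp⟩
  neg_mem' := by
    rintro f ⟨P, hP, i, j, rfl⟩
    exact ⟨P, hP, -i, j, by simp⟩

/-- Two parallel morphisms are stably equal if their difference factors through a projective
object. -/
def stableRel (C : Type u) [Category.{v} C] [Preadditive C] [Limits.HasBinaryBiproducts C]
    [Limits.HasZeroObject C] : HomRel C :=
  fun X Y f g => f - g ∈ projectiveMorphisms X Y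

instance stableRel_congruence : Congruence (stableRel C) where
  comp_left := by
    rintro X Y Z f g g' ⟨P, hP, i, j, h⟩
    exact ⟨P, hP, f ≫ i, j, by rw [Category.assoc, h, Preadditive.comp_sub]⟩
  comp_right := by
    rintro X Y Z f f' g ⟨P, hP, i, j, h⟩
    exact ⟨P, hP, i, j ≫ g, by rw [← Category.assoc, h, Preadditive.sub_comp]⟩
  equivalence :=
    { refl := fun f => by
        change f - f ∈ _
        rw [sub_self]
        exact zero_mem _
      symm := fun {f g} h => by
        change g - f ∈ _
        rw [← neg_sub]
        exact neg_mem h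
      trans := fun {f g l} h h' => by
        change f - l ∈ _
        rw [← sub_add_sub_cancel f g l]
        exact add_mem h h' }

/-- The stable category: the objects are those of `C`, and the morphisms are the morphisms of `C`
modulo those which factor through a projective object. -/
abbrev StableCategory (C : Type u) [Category.{v} C] [Preadditive C] [Limits.HasBinaryBiproducts C]
    [Limits.HasZeroObject C] : Type u :=
  CategoryTheory.Quotient (stableRel C)

/-- The functor on stable categories induced by an additive functor which preserves projective
objects; it sends an object `X` to `F X` and the class of `f` to the class of `F f`. -/
def stableFunctor (F : C ⥤ D) [F.Additive] (hF : ∀ P : C, Projective P → Projective (F.obj P)) :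
    StableCategory C ⥤ StableCategory D :=
  CategoryTheory.Quotient.lift (stableRel C) (F ⋙ CategoryTheory.Quotient.functor (stableRel D)) (by
    rintro X Y f g ⟨P, hP, i, j, h⟩
    exact CategoryTheory.Quotient.sound _
      ⟨F.obj P, hF P hP, F.map i, F.map j, by rw [← F.map_comp, h, F.map_sub]⟩)

/-- `F` induces a stable equivalence if it preserves projective objects and the induced functor on
stable categories is an equivalence. (For a `k`-linear functor `F` the induced functor is
automatically `k`-linear.) -/
def InducesStableEquivalence (F : C ⥤ D) [F.Additive] : Prop :=
  ∃ hF : ∀ P : C, Projective P → Projective (F.obj P), (stableFunctor F hF).IsEquivalence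

end Stable

/-! ## Basic algebras and gauge equivalence -/

/-- A finite-dimensional algebra over an algebraically closed field `k` is basic if its quotient by
the Jacobson radical is isomorphic to a product of copies of `k`. -/
def IsBasicAlgebra (k H : Type u) [Field k] [Ring H] [Algebra k H] : Prop :=
  ∃ n : ℕ, Nonempty ((H ⧸ Ring.jacobson H) ≃ₐ[k] (Fin n → k))

section Gauge

variable (k : Type u) {H : Type u} [Field k] [Ring H] [Bialgebra k H]

/-- An invertible element `J` of `H ⊗ H` is a (normalized) twist, or `2`-cocycle, if
`(ε ⊗ id)(J) = 1 = (id ⊗ ε)(J)` and `(1 ⊗ J) (id ⊗ Δ)(J) = (J ⊗ 1) (Δ ⊗ id)(J)`. Then `H` with the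
comultiplication `h ↦ J Δ(h) J⁻¹` and its original product and counit is again a bialgebra. -/
structure IsTwist (J : (H ⊗[k] H)ˣ) : Prop where
  counit_left : Algebra.TensorProduct.lid k H
    (Algebra.TensorProduct.map (Bialgebra.counitAlgHom k H) (AlgHom.id k H) J.1) = 1
  counit_right : Algebra.TensorProduct.rid k k H
    (Algebra.TensorProduct.map (AlgHom.id k H) (Bialgebra.counitAlgHom k H) J.1) = 1
  cocycle : (1 ⊗ₜ[k] J.1) *
      Algebra.TensorProduct.map (AlgHom.id k H) (Bialgebra.comulAlgHom k H) J.1 =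
    Algebra.TensorProduct.assoc k k k H H H ((J.1 ⊗ₜ[k] 1) *
      Algebra.TensorProduct.map (Bialgebra.comulAlgHom k H) (AlgHom.id k H) J.1)

/-- The twisted comultiplication `h ↦ J Δ(h) J⁻¹`. -/
def twistedComul (J : (H ⊗[k] H)ˣ) (h : H) : H ⊗[k] H :=
  J.1 * Coalgebra.comul h * J⁻¹.1

/-- `H` and `H'` are gauge equivalent if `H'` is isomorphic as a bialgebra (equivalently, as a Hopf
algebra) to the twist of `H` by some normalized `2`-cocycle `J`. -/
def GaugeEquivalent (H H' : Type u) [Ring H] [HopfAlgebra k H] [Ring H'] [HopfAlgebra k H'] :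
    Prop :=
  ∃ J : (H ⊗[k] H)ˣ, IsTwist k J ∧ ∃ σ : H ≃ₐ[k] H',
    (∀ h, Coalgebra.comul (R := k) (σ h) =
      Algebra.TensorProduct.map σ.toAlgHom σ.toAlgHom (twistedComul k J h)) ∧
    ∀ h, Coalgebra.counit (R := k) (σ h) = Coalgebra.counit (R := k) h

end Gauge

end

noncomputable section

namespace FinMod

section Algebra

variable {k A : Type u} [Field k] [Ring A] [Algebra k A]

/-! The strategy is to show that `F` sends the regular module of `H` to the regular module of `H'`.
A generator of the image then identifies `F`, as a functor to vector spaces, with the forgetful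
functor, and Tannakian reconstruction produces `σ` and `J`.

Over a basic algebra every module has a filtration with one-dimensional factors
(`induction_of_isBasic`), and over a Hopf algebra one-dimensional modules are tensor invertible. A
monoidal functor preserves invertibility, so by exactness `F` preserves dimension (`finrank_map`)
and is faithful (`map_eq_zero`). Since `H'` is not semisimple, its one-dimensional modules are not
projective, so a map between two of them that is stably zero is zero. The stable equivalence
therefore makes `F` full on one-dimensional modules, and each one-dimensional `H'`-module is the
image of one over `H` (`exists_iso_map_of_finrank_eq_one`).

The crux is fullness on maps `F X ⟶ F T` with `T` one-dimensional (`exists_map_eq`). Along a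
filtration of `X`, the obstruction to lifting is a map from the kernel of a projective cover to `T`.
Its image under `F` is stably zero, hence so is the map itself. Such a map is honestly zero: a
nonzero one would make that kernel surject onto the projective cover of `T`, whereas all covers of
one-dimensional modules have the same dimension (`eq_zero_of_mem_projectiveMorphisms`).

Consequently `F(H)` is projective and has each character as a quotient exactly once up to scalars,
which characterizes the regular module (`exists_bijective_fromReg`). Transported along the resulting
`FiberIso`, the `H'`-action gives `σ`, the tensorator of `F` is the action of `J⁻¹`, and the
coherence axioms of `F` are the axioms of a twist. -/

theorem lin_ρ {X Y : FinMod k A} (f : X ⟶ Y) (a : A) (x : X.V) :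
    f.lin (X.ρ a x) = Y.ρ a (f.lin x) :=
  LinearMap.congr_fun (f.mem a) x

theorem comp_apply {X Y Z : FinMod k A} (f : X ⟶ Y) (g : Y ⟶ Z) (x : X.V) :
    (f ≫ g).lin x = g.lin (f.lin x) := rfl

theorem hom_eq_zero_iff {X Y : FinMod k A} (f : X ⟶ Y) : f = 0 ↔ f.lin = 0 :=
  ⟨fun h => by rw [h]; rfl, fun h => hom_ext h⟩

/-- A morphism from a linear map which commutes with the action. -/
def mkHom {X Y : FinMod k A} (f : X.V →ₗ[k] Y.V) (hf : ∀ a x, f (X.ρ a x) = Y.ρ a (f x)) :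
    X ⟶ Y :=
  ⟨f, fun a => LinearMap.ext (hf a)⟩

/-! ### Submodules and quotients -/

/-- A subspace which is stable under the action, as a module. -/
def subMod (X : FinMod k A) (U : Submodule k X.V) (hU : ∀ a, ∀ x ∈ U, X.ρ a x ∈ U) :
    FinMod k A where
  V := U
  ρ := AlgHom.ofLinearMap
    { toFun := fun a => (X.ρ a).restrict (hU a)
      map_add' := fun a b => LinearMap.ext fun x => Subtype.ext (by simp)
      map_smul' := fun c a => LinearMap.ext fun x => Subtype.ext (by simp) }
    (LinearMap.ext fun x => Subtype.ext (by simp))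
    (fun a b => LinearMap.ext fun x => Subtype.ext (by simp))

/-- The inclusion of a submodule. -/
def subModι (X : FinMod k A) (U : Submodule k X.V) (hU : ∀ a, ∀ x ∈ U, X.ρ a x ∈ U) :
    subMod X U hU ⟶ X :=
  mkHom U.subtype fun _ _ => rfl

/-- The quotient by a stable subspace. -/
def quotMod (X : FinMod k A) (U : Submodule k X.V) (hU : ∀ a, ∀ x ∈ U, X.ρ a x ∈ U) :
    FinMod k A where
  V := X.V ⧸ U
  ρ := AlgHom.ofLinearMap
    { toFun := fun a => U.mapQ U (X.ρ a) (hU a)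
      map_add' := fun a b => Submodule.linearMap_qext _ (LinearMap.ext fun x => by simp)
      map_smul' := fun c a => Submodule.linearMap_qext _ (LinearMap.ext fun x => by simp) }
    (Submodule.linearMap_qext _ (LinearMap.ext fun x => by simp))
    (fun a b => Submodule.linearMap_qext _ (LinearMap.ext fun x => by simp))

/-- The projection to a quotient. -/
def quotModπ (X : FinMod k A) (U : Submodule k X.V) (hU : ∀ a, ∀ x ∈ U, X.ρ a x ∈ U) :
    X ⟶ quotMod X U hU :=
  mkHom U.mkQ fun _ _ => rfl

theorem ker_stable {X Y : FinMod k A} (f : X ⟶ Y) (a : A) :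
    ∀ x ∈ LinearMap.ker f.lin, X.ρ a x ∈ LinearMap.ker f.lin := fun x hx => by
  rw [LinearMap.mem_ker] at hx ⊢
  rw [lin_ρ, hx, map_zero]

theorem range_stable {X Y : FinMod k A} (f : X ⟶ Y) (a : A) :
    ∀ y ∈ LinearMap.range f.lin, Y.ρ a y ∈ LinearMap.range f.lin := by
  rintro _ ⟨x, rfl⟩
  exact ⟨X.ρ a x, lin_ρ f a x⟩

theorem mono_iff_injective {X Y : FinMod k A} (f : X ⟶ Y) :
    Mono f ↔ Function.Injective f.lin := by
  constructor
  · intro _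
    have h : subModι X _ (ker_stable f) = 0 := by
      rw [← cancel_mono f, Limits.zero_comp]
      exact hom_ext (LinearMap.ext fun x => LinearMap.mem_ker.1 (Subtype.prop x))
    rw [← LinearMap.ker_eq_bot, LinearMap.ker_eq_bot']
    intro x hx
    exact LinearMap.congr_fun ((hom_eq_zero_iff _).1 h) ⟨x, hx⟩
  · intro hf
    exact ⟨fun g h e => hom_ext (LinearMap.ext fun x => hf
      (LinearMap.congr_fun (congrArg Hom.lin e) x))⟩

theorem epi_iff_surjective {X Y : FinMod k A} (f : X ⟶ Y) :
    Epi f ↔ Function.Surjective f.lin := by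
  constructor
  · intro _
    have h : quotModπ Y _ (range_stable f) = 0 := by
      rw [← cancel_epi f]
      exact hom_ext (LinearMap.ext fun x => (Submodule.Quotient.mk_eq_zero _).2 ⟨x, rfl⟩)
    intro y
    exact (Submodule.Quotient.mk_eq_zero _).1 (LinearMap.congr_fun ((hom_eq_zero_iff _).1 h) y)
  · intro hf
    refine ⟨fun g h e => hom_ext (LinearMap.ext fun y => ?_)⟩
    obtain ⟨x, rfl⟩ := hf y
    exact LinearMap.congr_fun (congrArg Hom.lin e) x

theorem isIso_of_bijective {X Y : FinMod k A} (f : X ⟶ Y) (hf : Function.Bijective f.lin) :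
    IsIso f :=
  (mkIso (LinearEquiv.ofBijective f.lin hf) f.mem).isIso_hom

theorem bijective_lin {X Y : FinMod k A} (e : X ≅ Y) : Function.Bijective e.hom.lin :=
  ⟨(mono_iff_injective _).1 inferInstance, (epi_iff_surjective _).1 inferInstance⟩

/-- The linear equivalence underlying an isomorphism. -/
def linEquiv {X Y : FinMod k A} (e : X ≅ Y) : X.V ≃ₗ[k] Y.V :=
  LinearEquiv.ofBijective e.hom.lin (bijective_lin e)

theorem finrank_eq_of_iso {X Y : FinMod k A} (e : X ≅ Y) :
    Module.finrank k X.V = Module.finrank k Y.V :=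
  (linEquiv e).finrank_eq

/-! ### Factorizations -/

theorem exists_factor_of_surjective {X Y Z : FinMod k A} (s : Y ⟶ X)
    (hs : Function.Surjective s.lin) (t : Y ⟶ Z)
    (h : LinearMap.ker s.lin ≤ LinearMap.ker t.lin) : ∃ t' : X ⟶ Z, s ≫ t' = t := by
  obtain ⟨r, hr⟩ := s.lin.exists_rightInverse_of_surjective (LinearMap.range_eq_top.2 hs)
  have key : ∀ y, t.lin (r (s.lin y)) = t.lin y := fun y => by
    rw [← sub_eq_zero, ← map_sub]
    refine h ?_
    rw [LinearMap.mem_ker, map_sub, sub_eq_zero]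
    exact LinearMap.congr_fun hr (s.lin y)
  refine ⟨mkHom (t.lin ∘ₗ r) fun a x => ?_, hom_ext (LinearMap.ext key)⟩
  obtain ⟨y, rfl⟩ := hs x
  simp only [LinearMap.comp_apply]
  rw [← lin_ρ, key, key, lin_ρ]

theorem exists_lift_of_injective {X Y Z : FinMod k A} (i : X ⟶ Y)
    (hi : Function.Injective i.lin) (t : Z ⟶ Y)
    (h : LinearMap.range t.lin ≤ LinearMap.range i.lin) : ∃ t' : Z ⟶ X, t' ≫ i = t := by
  obtain ⟨r, hr⟩ := i.lin.exists_leftInverse_of_injective (LinearMap.ker_eq_bot.2 hi)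
  have key : ∀ z, i.lin (r (t.lin z)) = t.lin z := fun z => by
    obtain ⟨x, hx⟩ := h ⟨z, rfl⟩
    rw [← hx]
    exact congrArg i.lin (LinearMap.congr_fun hr x)
  refine ⟨mkHom (r ∘ₗ t.lin) fun a z => hi ?_, hom_ext (LinearMap.ext key)⟩
  simp only [LinearMap.comp_apply]
  rw [key, lin_ρ, lin_ρ, key]

/-- A short exact sequence. -/
structure IsSES {X Y Z : FinMod k A} (i : X ⟶ Y) (p : Y ⟶ Z) : Prop where
  inj : Function.Injective i.lin
  surj : Function.Surjective p.lin
  exact : LinearMap.range i.lin = LinearMap.ker p.lin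

namespace IsSES

variable {X Y Z : FinMod k A} {i : X ⟶ Y} {p : Y ⟶ Z}

theorem zero (h : IsSES i p) : i ≫ p = 0 :=
  hom_ext (LinearMap.ext fun x => h.exact.le ⟨x, rfl⟩)

theorem finrank_eq (h : IsSES i p) :
    Module.finrank k Y.V = Module.finrank k X.V + Module.finrank k Z.V := by
  rw [← p.lin.finrank_range_add_finrank_ker, ← h.exact, LinearMap.finrank_range_of_inj h.inj,
    LinearMap.range_eq_top.2 h.surj, finrank_top, add_comm]

theorem exists_desc (h : IsSES i p) {W : FinMod k A} (t : Y ⟶ W) (ht : i ≫ t = 0) :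
    ∃ t' : Z ⟶ W, p ≫ t' = t :=
  exists_factor_of_surjective p h.surj t (by
    rw [← h.exact]
    rintro _ ⟨x, rfl⟩
    exact LinearMap.congr_fun ((hom_eq_zero_iff _).1 ht) x)

theorem exists_lift (h : IsSES i p) {W : FinMod k A} (t : W ⟶ Y) (ht : t ≫ p = 0) :
    ∃ t' : W ⟶ X, t' ≫ i = t :=
  exists_lift_of_injective i h.inj t (by
    rw [h.exact]
    rintro _ ⟨x, rfl⟩
    exact LinearMap.congr_fun ((hom_eq_zero_iff _).1 ht) x)

end IsSES

theorem exists_isSES_of_surjective {Y Z : FinMod k A} (p : Y ⟶ Z)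
    (hp : Function.Surjective p.lin) : ∃ (X : FinMod k A) (i : X ⟶ Y), IsSES i p :=
  ⟨_, subModι Y _ (ker_stable p), Subtype.val_injective, hp, Submodule.range_subtype _⟩

/-! ### Projective modules -/

theorem exists_lift_of_projective {P E X : FinMod k A} (hP : Projective P) (f : P ⟶ X) (e : E ⟶ X)
    (he : Function.Surjective e.lin) : ∃ g : P ⟶ E, g ≫ e = f := by
  have := (epi_iff_surjective e).2 he
  exact hP.factors f e

/-- The regular module. -/
def reg (k A : Type u) [Field k] [Ring A] [Algebra k A] [FiniteDimensional k A] : FinMod k A where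
  V := A
  ρ := Algebra.lmul k A

section reg

variable [FiniteDimensional k A]

/-- The elements of the regular module are the elements of the algebra. -/
def regEquiv (k A : Type u) [Field k] [Ring A] [Algebra k A] [FiniteDimensional k A] :
    A ≃ₗ[k] (reg k A).V :=
  LinearEquiv.refl k A

theorem reg_ρ (a b : A) : (reg k A).ρ a (regEquiv k A b) = regEquiv k A (a * b) := rfl

theorem reg_ρ_one (a : A) : (reg k A).ρ a (regEquiv k A 1) = regEquiv k A a := by
  rw [reg_ρ, mul_one]

/-- The morphism from the regular module which sends `1` to a given element. -/
def fromReg (X : FinMod k A) (x : X.V) : reg k A ⟶ X :=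
  mkHom ((LinearMap.applyₗ x).comp X.ρ.toLinearMap) fun a (b : A) => by
    change X.ρ (a * b) x = X.ρ a (X.ρ b x)
    rw [map_mul]
    rfl

theorem fromReg_apply (X : FinMod k A) (x : X.V) (a : A) :
    (fromReg X x).lin (regEquiv k A a) = X.ρ a x := rfl

theorem fromReg_one (X : FinMod k A) (x : X.V) : (fromReg X x).lin (regEquiv k A 1) = x := by
  rw [fromReg_apply, map_one]
  rfl

theorem reg_hom_ext {X : FinMod k A} {f g : reg k A ⟶ X}
    (h : f.lin (regEquiv k A 1) = g.lin (regEquiv k A 1)) : f = g := by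
  refine hom_ext (LinearMap.ext fun a => ?_)
  obtain ⟨a, rfl⟩ := (regEquiv k A).surjective a
  rw [← reg_ρ_one, lin_ρ, lin_ρ, h]

theorem fromReg_comp {X Y : FinMod k A} (x : X.V) (f : X ⟶ Y) :
    fromReg X x ≫ f = fromReg Y (f.lin x) :=
  reg_hom_ext (by rw [fromReg_one, comp_apply, fromReg_one])

instance projective_reg : Projective (reg k A) where
  factors {E X} f e he := by
    obtain ⟨y, hy⟩ := (epi_iff_surjective e).1 he (f.lin (regEquiv k A 1))
    exact ⟨fromReg E y, reg_hom_ext (by rw [comp_apply, fromReg_one, hy])⟩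

end reg

/-! ### One-dimensional modules -/

/-- The one-dimensional module given by a character. -/
def charMod (χ : A →ₐ[k] k) : FinMod k A where
  V := k
  ρ := (Algebra.ofId k (Module.End k k)).comp χ

theorem finrank_charMod (χ : A →ₐ[k] k) : Module.finrank k (charMod χ).V = 1 :=
  Module.finrank_self k

theorem lin_surjective_of_ne_zero {X T : FinMod k A} (hT : Module.finrank k T.V = 1) {f : X ⟶ T}
    (hf : f ≠ 0) : Function.Surjective f.lin := by
  have hf' : f.lin ≠ 0 := fun h => hf ((hom_eq_zero_iff f).2 h)
  rw [← LinearMap.range_eq_top]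
  have h1 : LinearMap.range f.lin ≠ ⊥ := fun h => hf' (LinearMap.range_eq_bot.1 h)
  refine Submodule.eq_top_of_finrank_eq (le_antisymm (Submodule.finrank_le _) ?_)
  rw [hT]
  exact Submodule.one_le_finrank_iff.2 h1

theorem isIso_of_ne_zero {S T : FinMod k A} (hS : Module.finrank k S.V = 1)
    (hT : Module.finrank k T.V = 1) {f : S ⟶ T} (hf : f ≠ 0) : IsIso f := by
  have hs := lin_surjective_of_ne_zero hT hf
  exact isIso_of_bijective f
    ⟨(LinearMap.injective_iff_surjective_of_finrank_eq_finrank (hS.trans hT.symm)).2 hs, hs⟩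

/-- If `f x₀ = 1`, the scalars are `χ a = f (a x₀)`, and the scaling relation makes this
multiplicative. -/
theorem exists_charMod_hom {X : FinMod k A} (f : X.V →ₗ[k] k) (hf : f ≠ 0)
    (h : ∀ a, ∃ c : k, ∀ x, f (X.ρ a x) = c * f x) :
    ∃ (χ : A →ₐ[k] k) (g : X ⟶ charMod χ), g.lin = f := by
  choose χ hχ using h
  obtain ⟨x₀, hx₀⟩ : ∃ x, f x = 1 := by
    obtain ⟨x, hx⟩ : ∃ x, f x ≠ 0 := by
      by_contra! hc
      exact hf (LinearMap.ext hc)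
    exact ⟨(f x)⁻¹ • x, by rw [map_smul, smul_eq_mul, inv_mul_cancel₀ hx]⟩
  have e : ∀ a, χ a = f (X.ρ a x₀) := fun a => by rw [hχ, hx₀, mul_one]
  refine ⟨AlgHom.ofLinearMap (f ∘ₗ (LinearMap.applyₗ x₀).comp X.ρ.toLinearMap) ?_ ?_, mkHom f ?_,
    rfl⟩
  · exact (e 1).symm.trans (by rw [e, map_one, Module.End.one_apply, hx₀])
  · intro a b
    change f (X.ρ (a * b) x₀) = f (X.ρ a x₀) * f (X.ρ b x₀)
    rw [map_mul, Module.End.mul_apply, hχ, e]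
  · intro a x
    refine (hχ a x).trans ?_
    rw [e]
    rfl

theorem exists_iso_charMod {T : FinMod k A} (hT : Module.finrank k T.V = 1) :
    ∃ χ : A →ₐ[k] k, Nonempty (T ≅ charMod χ) := by
  have e : T.V ≃ₗ[k] k := LinearEquiv.ofFinrankEq _ _ (hT.trans (Module.finrank_self k).symm)
  obtain ⟨χ, g, hg⟩ := exists_charMod_hom (X := T) e.toLinearMap (fun h => by
      have : e (e.symm 1) = 0 := LinearMap.congr_fun h _
      rw [e.apply_symm_apply] at this
      exact one_ne_zero this) (fun a => ⟨e (T.ρ a (e.symm 1)), fun x => by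
        have : x = e x • e.symm 1 := by
          rw [← map_smul, smul_eq_mul, mul_one, e.symm_apply_apply]
        conv_lhs => rw [this]
        rw [map_smul]
        simp [mul_comm]⟩)
  have : IsIso g := isIso_of_bijective g (by rw [hg]; exact e.bijective)
  exact ⟨χ, ⟨asIso g⟩⟩

/-! ### Modules over basic algebras -/

/-- Commutators lie in the Jacobson radical and so annihilate a simple module. Each `a` thus acts by
a module endomorphism, which is a scalar by Schur's lemma. -/
theorem exists_charMod_of_simple [IsAlgClosed k] (hb : IsBasicAlgebra k A)
    (Q : Type u) [AddCommGroup Q] [Module k Q] [Module A Q] [IsScalarTower k A Q]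
    [FiniteDimensional k Q] [IsSimpleModule A Q] (a : A) : ∃ c : k, ∀ q : Q, a • q = c • q := by
  obtain ⟨n, ⟨φ⟩⟩ := hb
  have hcomm : ∀ b : A, ∀ q : Q, a • b • q = b • a • q := fun b q => by
    have h : a * b - b * a ∈ Ring.jacobson A := by
      rw [← Ideal.Quotient.eq_zero_iff_mem]
      apply φ.injective
      simp [mul_comm]
    have h' := (IsSemisimpleModule.jacobson_le_annihilator A Q) h
    rw [Module.mem_annihilator] at h'
    have := h' q
    rwa [sub_smul, sub_eq_zero, mul_smul, mul_smul] at this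
  let f : Q →ₗ[A] Q :=
    { toFun := fun q => a • q
      map_add' := smul_add a
      map_smul' := hcomm }
  obtain ⟨c, hc⟩ := (IsSimpleModule.algebraMap_end_bijective_of_isAlgClosed (A := A) (V := Q) k).2 f
  exact ⟨c, fun q => (LinearMap.congr_fun hc q).symm⟩

/-- The algebra acts by scalars on a simple quotient, so any linear functional that is nonzero there
is a morphism to a character. -/
theorem exists_hom_charMod_ne_zero [IsAlgClosed k] (hb : IsBasicAlgebra k A) (X : FinMod k A)
    [Nontrivial X.V] : ∃ (χ : A →ₐ[k] k) (f : X ⟶ charMod χ), f ≠ 0 := by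
  let : Module A X.V := Module.compHom X.V X.ρ.toRingHom
  have smul_def : ∀ (a : A) (x : X.V), a • x = X.ρ a x := fun _ _ => rfl
  have : IsScalarTower k A X.V := ⟨fun c a x => by simp [smul_def]⟩
  have : Module.Finite A X.V := Module.Finite.of_restrictScalars_finite k A X.V
  obtain ⟨U, hU, -⟩ := (eq_top_or_exists_le_coatom (⊥ : Submodule A X.V)).resolve_left bot_ne_top
  have : IsSimpleModule A (X.V ⧸ U) := isSimpleModule_iff_isCoatom.2 hU
  have : Module.Finite k (X.V ⧸ U) :=
    Module.Finite.of_surjective (U.mkQ.restrictScalars k) U.mkQ_surjective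
  have : Nontrivial (X.V ⧸ U) := IsSimpleModule.nontrivial A _
  obtain ⟨q, hq⟩ := exists_ne (0 : X.V ⧸ U)
  obtain ⟨l, hl⟩ := Module.exists_dual_forall_apply_ne_zero (K := k) (fun _ : Unit => q) (fun _ => hq)
  have hl : l q ≠ 0 := hl ()
  obtain ⟨x, rfl⟩ := U.mkQ_surjective q
  obtain ⟨χ, g, hg⟩ := exists_charMod_hom (X := X) (l ∘ₗ U.mkQ.restrictScalars k)
    (fun h => hl (LinearMap.congr_fun h x)) (fun a => by
      obtain ⟨c, hc⟩ := exists_charMod_of_simple hb (X.V ⧸ U) a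
      exact ⟨c, fun y => by
        change l (U.mkQ (a • y)) = c * l (U.mkQ y)
        rw [map_smul, hc, map_smul, smul_eq_mul]⟩)
  refine ⟨χ, g, fun h => hl ?_⟩
  have : g.lin x = 0 := LinearMap.congr_fun ((hom_eq_zero_iff _).1 h) x
  rw [hg] at this
  exact this

/-- Dévissage: strong induction on the dimension, splitting off a one-dimensional quotient at each
step. -/
theorem induction_of_isBasic [IsAlgClosed k] (hb : IsBasicAlgebra k A) {p : FinMod k A → Prop}
    (zero : ∀ X : FinMod k A, Subsingleton X.V → p X)
    (step : ∀ {X Y : FinMod k A} {χ : A →ₐ[k] k} {i : X ⟶ Y} {q : Y ⟶ charMod χ},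
      IsSES i q → p X → p Y) (X : FinMod k A) : p X := by
  induction hn : Module.finrank k X.V using Nat.strong_induction_on generalizing X with
  | _ n ih =>
    rcases subsingleton_or_nontrivial X.V with h | h
    · exact zero X h
    · obtain ⟨χ, f, hf⟩ := exists_hom_charMod_ne_zero hb X
      obtain ⟨X', i, hi⟩ := exists_isSES_of_surjective f
        (lin_surjective_of_ne_zero (finrank_charMod χ) hf)
      have := hi.finrank_eq
      rw [finrank_charMod] at this
      exact step hi (ih _ (by omega) X' rfl)

end Algebra

end FinMod

namespace FinMod

section Algebra

variable {k A : Type u} [Field k] [Ring A] [Algebra k A]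

/-! ### Projective covers of one-dimensional modules -/

/-- A projective module of minimal dimension among those with a nonzero map to `T`. -/
structure IsMinimalProjective {P T : FinMod k A} (π : P ⟶ T) : Prop where
  projective : Projective P
  ne_zero : π ≠ 0
  le : ∀ {Q : FinMod k A} (f : Q ⟶ T), Projective Q → f ≠ 0 →
    Module.finrank k P.V ≤ Module.finrank k Q.V

theorem exists_isMinimalProjective [FiniteDimensional k A] {T : FinMod k A}
    (hT : Module.finrank k T.V = 1) :
    ∃ (P : FinMod k A) (π : P ⟶ T), IsMinimalProjective π := by
  have hex : ∃ n, ∃ (P : FinMod k A) (π : P ⟶ T), Projective P ∧ π ≠ 0 ∧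
      Module.finrank k P.V = n := by
    have : Nontrivial T.V := Module.nontrivial_of_finrank_pos (R := k) (by omega)
    obtain ⟨t, ht⟩ := exists_ne (0 : T.V)
    refine ⟨_, reg k A, fromReg T t, inferInstance, fun h => ht ?_, rfl⟩
    rw [← fromReg_one T t, h]
    rfl
  classical
  obtain ⟨P, π, hP, hπ, hn⟩ := Nat.find_spec hex
  exact ⟨P, π, hP, hπ, fun f hQ hf => hn ▸ Nat.find_min' hex ⟨_, f, hQ, hf, rfl⟩⟩

theorem exists_pow_lin {P T : FinMod k A} (π : P ⟶ T) (a : P ⟶ P) (ha : a ≫ π = π) (n : ℕ) :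
    ∃ c : P ⟶ P, c.lin = a.lin ^ n ∧ c ≫ π = π := by
  induction n with
  | zero => exact ⟨𝟙 P, rfl, Category.id_comp _⟩
  | succ n ih =>
    obtain ⟨c, hc, hc'⟩ := ih
    exact ⟨a ≫ c, by rw [comp_lin, hc, pow_succ]; rfl, by rw [Category.assoc, hc', ha]⟩

/-- This is the essentiality of a projective cover, obtained from minimality of dimension: a lift
`b` of `π` through `j ≫ π` gives an endomorphism `b ≫ j` of `P` over `T`, to which Fitting's lemma
applies. -/
theorem IsMinimalProjective.surjective {P T : FinMod k A} {π : P ⟶ T}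
    (hT : Module.finrank k T.V = 1) (h : IsMinimalProjective π) {U : FinMod k A} (j : U ⟶ P)
    (hj : j ≫ π ≠ 0) : Function.Surjective j.lin := by
  obtain ⟨b, hb⟩ := exists_lift_of_projective h.projective π (j ≫ π)
    (lin_surjective_of_ne_zero hT hj)
  obtain ⟨n, hn⟩ := (Filter.eventually_atTop.1
    (LinearMap.eventually_isCompl_ker_pow_range_pow (b ≫ j).lin))
  -- The exponent must be positive, so that the range of the power lies in the range of `j`.
  have hn := hn (n + 1) n.le_succ
  obtain ⟨c, hc, hcπ⟩ := exists_pow_lin π (b ≫ j) (by rw [Category.assoc, hb]) (n + 1)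
  rw [← hc] at hn
  let R := subMod P _ (range_stable c)
  let ι : R ⟶ P := subModι P _ (range_stable c)
  have hι : Function.Injective ι.lin := Subtype.val_injective
  obtain ⟨q, hq⟩ := exists_lift_of_injective ι hι c (Submodule.range_subtype _).ge
  have hinj : Function.Injective (ι ≫ q).lin := by
    rw [← LinearMap.ker_eq_bot, LinearMap.ker_eq_bot']
    intro x hx
    refine hι ((Submodule.disjoint_def.1 hn.disjoint _ ?_ x.2).trans (map_zero _).symm)
    exact (LinearMap.congr_fun (congrArg Hom.lin hq.symm) (ι.lin x)).trans
      ((congrArg ι.lin hx).trans (map_zero _))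
  have : IsIso (ι ≫ q) := isIso_of_bijective _
    ⟨hinj, LinearMap.injective_iff_surjective.1 hinj⟩
  -- The range is a Fitting summand of `P`, hence projective, and `π` is nonzero on it because `c ≫
  -- π = π`. Minimality then forces it to be all of `P`.
  have hR : Projective R :=
    have := h.projective
    Retract.projective ⟨ι, q ≫ inv (ι ≫ q), by rw [← Category.assoc, IsIso.hom_inv_id]⟩
  have hle := h.le (ι ≫ π) hR (fun h0 => h.ne_zero (by
    rw [← hcπ, ← hq, Category.assoc, h0, Limits.comp_zero]))
  have htop : LinearMap.range c.lin = ⊤ :=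
    Submodule.eq_top_of_finrank_eq (le_antisymm (Submodule.finrank_le _) hle)
  intro y
  obtain ⟨x, rfl⟩ := LinearMap.range_eq_top.1 htop y
  refine ⟨b.lin (((b ≫ j).lin ^ n) x), ?_⟩
  rw [hc, pow_succ']
  rfl

/-- Extensions of projective modules by projective modules are projective. -/
theorem IsSES.projective {X Y Z : FinMod k A} {i : X ⟶ Y} {p : Y ⟶ Z} (h : IsSES i p)
    (hX : Projective X) (hZ : Projective Z) : Projective Y where
  factors {E W} f e he := by
    have he := (epi_iff_surjective e).1 he
    obtain ⟨s, hs⟩ := exists_lift_of_projective hZ (𝟙 Z) p h.surj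
    obtain ⟨r, hr⟩ := h.exists_lift (𝟙 Y - p ≫ s) (by
      rw [Preadditive.sub_comp, Category.assoc, hs]
      simp)
    obtain ⟨g₁, hg₁⟩ := exists_lift_of_projective hX (i ≫ f) e he
    obtain ⟨g₂, hg₂⟩ := exists_lift_of_projective hZ (s ≫ f) e he
    refine ⟨r ≫ g₁ + p ≫ g₂, ?_⟩
    rw [Preadditive.add_comp, Category.assoc, Category.assoc, hg₁, hg₂, ← Category.assoc, hr,
      ← Category.assoc p, ← Preadditive.add_comp, sub_add_cancel, Category.id_comp]

/-- By dévissage every module is projective, so the quotient by the radical splits off the regular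
module. The image `i` of `1` under the splitting is forced to be `1`, while the radical kills `i`.
-/
theorem isSemisimpleRing_of_projective_charMod [IsAlgClosed k] [FiniteDimensional k A]
    (hb : IsBasicAlgebra k A) (h : ∀ χ : A →ₐ[k] k, Projective (charMod χ)) :
    IsSemisimpleRing A := by
  have hall : ∀ X : FinMod k A, Projective X := fun X => by
    refine induction_of_isBasic hb (fun X hX => ⟨fun {E W} f e _ => ⟨0, ?_⟩⟩)
      (fun hi hX => hi.projective hX (h _)) X
    refine hom_ext (LinearMap.ext fun x => ?_)
    rw [Subsingleton.elim x 0, map_zero, map_zero]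
  have : IsArtinianRing A := IsArtinianRing.of_finite k A
  rw [IsArtinianRing.isSemisimpleRing_iff_jacobson, eq_bot_iff]
  let J : Submodule k (reg k A).V := (Ring.jacobson A).restrictScalars k
  have hJ : ∀ a, ∀ x ∈ J, (reg k A).ρ a x ∈ J := fun a x hx =>
    (Ring.jacobson A).mul_mem_left a hx
  let π := quotModπ (reg k A) J hJ
  have hπ : Function.Surjective π.lin := J.mkQ_surjective
  obtain ⟨s, hs⟩ := exists_lift_of_projective (hall (quotMod (reg k A) J hJ)) (𝟙 _) π hπ
  obtain ⟨i, hi⟩ := (regEquiv k A).surjective (s.lin (π.lin (regEquiv k A 1)))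
  have h1 : (1 - i : A) ∈ Ring.jacobson A := by
    have : π.lin (regEquiv k A (1 - i)) = 0 := by
      rw [map_sub, map_sub, sub_eq_zero, hi, ← comp_apply, hs]
      rfl
    exact (Submodule.Quotient.mk_eq_zero _).1 this
  have h2 : ∀ j ∈ Ring.jacobson A, j * i = 0 := fun j hj => by
    apply (regEquiv k A).injective
    have hz : π.lin (regEquiv k A j) = 0 := (Submodule.Quotient.mk_eq_zero J).2 hj
    rw [← reg_ρ, hi, ← lin_ρ, ← lin_ρ, reg_ρ_one, hz, map_zero, map_zero]
  intro j hj
  -- As `1 - i` is in the radical, `i` has a left inverse; being idempotent, it equals `1`.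
  obtain ⟨z, hz⟩ := Ideal.exists_mul_sub_mem_of_sub_one_mem_jacobson (I := ⊥) i (by
    rw [Ideal.jacobson_bot, ← neg_sub]
    exact neg_mem h1)
  have hz : z * i = 1 := sub_eq_zero.1 hz
  have hii : i = i * i := by
    have := h2 _ h1
    rwa [sub_mul, one_mul, sub_eq_zero] at this
  have hi1 : i = 1 := by
    rw [← one_mul i, ← hz, mul_assoc, ← hii]
  have := h2 j hj
  rwa [hi1, mul_one] at this

end Algebra

/-! ### Invertible modules over a Hopf algebra -/

section Hopf

open MonoidalCategory

variable {k H : Type u} [Field k] [Ring H] [HopfAlgebra k H]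

/-- The inverse of a character with respect to convolution. -/
def charInv (χ : H →ₐ[k] k) : H →ₐ[k] k :=
  AlgHom.ofLinearMap (χ.toLinearMap ∘ₗ HopfAlgebra.antipode k) (by simp) (fun a b => by
    simp [HopfAlgebra.antipode_mul_antidistrib, mul_comm])

theorem charInv_apply (χ : H →ₐ[k] k) (a : H) :
    charInv χ a = χ (HopfAlgebra.antipode k a) := rfl

theorem lid_pairAction_charMod (χ ψ : H →ₐ[k] k) (t : H ⊗[k] H) :
    (TensorProduct.lid k k).toLinearMap ∘ₗ pairAction (charMod χ) (charMod ψ) t =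
      (TensorProduct.lid k k (TensorProduct.map χ.toLinearMap ψ.toLinearMap t)) •
        (TensorProduct.lid k k).toLinearMap := by
  induction t with
  | zero => simp; rfl
  | add s t hs ht =>
    simp only [map_add, add_smul, ← hs, ← ht]
    exact LinearMap.comp_add _ _ _
  | tmul a b =>
    refine TensorProduct.ext' fun (x : k) (y : k) => ?_
    change (χ a * x) * (ψ b * y) = (χ a * ψ b) * (x * y)
    ring

/-- If the convolution of two characters is the counit then their tensor product is trivial. -/
def tensorCharIso (χ ψ : H →ₐ[k] k)
    (h : ∀ a : H, TensorProduct.lid k k (TensorProduct.map χ.toLinearMap ψ.toLinearMap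
      (Coalgebra.comul a)) = Coalgebra.counit (R := k) a) :
    charMod χ ⊗ charMod ψ ≅ 𝟙_ (FinMod k H) :=
  mkIso (X := tensor (charMod χ) (charMod ψ)) (Y := trivial k H) (TensorProduct.lid k k)
    fun a => by
      refine (lid_pairAction_charMod χ ψ (Coalgebra.comul a)).trans ?_
      rw [h]
      rfl

theorem conv_charInv (χ : H →ₐ[k] k) (a : H) :
    TensorProduct.lid k k (TensorProduct.map χ.toLinearMap (charInv χ).toLinearMap
      (Coalgebra.comul a)) = Coalgebra.counit (R := k) a := by
  have e : ∀ t : H ⊗[k] H, TensorProduct.lid k k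
      (TensorProduct.map χ.toLinearMap (charInv χ).toLinearMap t) =
      χ (LinearMap.mul' k H ((HopfAlgebra.antipode k).lTensor H t)) := fun t => by
    induction t with
    | zero => simp
    | add s t hs ht => simp only [map_add, hs, ht]
    | tmul a b => simp [charInv_apply]
  rw [e, HopfAlgebra.mul_antipode_lTensor_comul_apply]
  simp

theorem charInv_conv (χ : H →ₐ[k] k) (a : H) :
    TensorProduct.lid k k (TensorProduct.map (charInv χ).toLinearMap χ.toLinearMap
      (Coalgebra.comul a)) = Coalgebra.counit (R := k) a := by
  have e : ∀ t : H ⊗[k] H, TensorProduct.lid k k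
      (TensorProduct.map (charInv χ).toLinearMap χ.toLinearMap t) =
      χ (LinearMap.mul' k H ((HopfAlgebra.antipode k).rTensor H t)) := fun t => by
    induction t with
    | zero => simp
    | add s t hs ht => simp only [map_add, hs, ht]
    | tmul a b => simp [charInv_apply]
  rw [e, HopfAlgebra.mul_antipode_rTensor_comul_apply]
  simp

theorem finrank_tensor (X Y : FinMod k H) :
    Module.finrank k (X ⊗ Y).V = Module.finrank k X.V * Module.finrank k Y.V :=
  Module.finrank_tensorProduct

theorem finrank_unit : Module.finrank k (𝟙_ (FinMod k H)).V = 1 :=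
  Module.finrank_self k

theorem exists_tensor_inverse {T : FinMod k H} (hT : Module.finrank k T.V = 1) :
    ∃ T' : FinMod k H, Module.finrank k T'.V = 1 ∧ Nonempty (T ⊗ T' ≅ 𝟙_ _) ∧
      Nonempty (T' ⊗ T ≅ 𝟙_ _) := by
  obtain ⟨χ, ⟨e⟩⟩ := exists_iso_charMod hT
  exact ⟨charMod (charInv χ), finrank_charMod _,
    ⟨whiskerRightIso e _ ≪≫ tensorCharIso _ _ (conv_charInv χ)⟩,
    ⟨whiskerLeftIso _ e ≪≫ tensorCharIso _ _ (charInv_conv χ)⟩⟩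

/-- Tensoring with an invertible module is an equivalence. -/
def tensorRightEquivalence {T T' : FinMod k H} (e : T ⊗ T' ≅ 𝟙_ _) (e' : T' ⊗ T ≅ 𝟙_ _) :
    FinMod k H ≌ FinMod k H :=
  CategoryTheory.Equivalence.mk (tensorRight T) (tensorRight T')
    ((rightUnitorNatIso _).symm ≪≫ (tensoringRight _).mapIso e.symm ≪≫ tensorRightTensor T T')
    ((tensorRightTensor T' T).symm ≪≫ (tensoringRight _).mapIso e' ≪≫ rightUnitorNatIso _)

theorem projective_tensor {P T : FinMod k H} (hP : Projective P)
    (hT : Module.finrank k T.V = 1) : Projective (P ⊗ T) := by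
  obtain ⟨T', -, ⟨e⟩, ⟨e'⟩⟩ := exists_tensor_inverse hT
  exact ((tensorRightEquivalence e e').map_projective_iff P).2 hP

theorem exists_tensor_iso {S T : FinMod k H} (hS : Module.finrank k S.V = 1)
    (hT : Module.finrank k T.V = 1) :
    ∃ U : FinMod k H, Module.finrank k U.V = 1 ∧ Nonempty (S ⊗ U ≅ T) := by
  obtain ⟨S', hS', ⟨e⟩, -⟩ := exists_tensor_inverse hS
  exact ⟨S' ⊗ T, by rw [finrank_tensor, hS', hT],
    ⟨(α_ S S' T).symm ≪≫ whiskerRightIso e T ≪≫ λ_ T⟩⟩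

/-- Every character is a tensor product of `T` with a one-dimensional module, so projectivity of `T`
would spread to all of them. -/
theorem not_projective_of_finrank_eq_one [IsAlgClosed k] [FiniteDimensional k H]
    (hb : IsBasicAlgebra k H) (hss : ¬ IsSemisimpleRing H) {T : FinMod k H}
    (hT : Module.finrank k T.V = 1) : ¬ Projective T := fun h =>
  hss (isSemisimpleRing_of_projective_charMod hb fun χ => by
    obtain ⟨U, hU, ⟨e⟩⟩ := exists_tensor_iso hT (finrank_charMod χ)
    exact Projective.of_iso e (projective_tensor h hU))

/-- Minimal projectives of all one-dimensional modules have the same dimension. -/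
theorem IsMinimalProjective.finrank_le {P S Q T : FinMod k H} {π : P ⟶ S} {q : Q ⟶ T}
    (hS : Module.finrank k S.V = 1) (hT : Module.finrank k T.V = 1)
    (hπ : IsMinimalProjective π) (hq : IsMinimalProjective q) :
    Module.finrank k P.V ≤ Module.finrank k Q.V := by
  obtain ⟨U, hU, ⟨e⟩⟩ := exists_tensor_iso hT hS
  -- With `T ⊗ U ≅ S`, the module `Q ⊗ U` is projective, has a nonzero map to `S` and has the
  -- dimension of `Q`.
  have := hπ.le ((q ▷ U) ≫ e.hom) (projective_tensor hq.projective hU) (fun h => by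
    have hU' := exists_tensor_inverse hU
    obtain ⟨U', -, ⟨i⟩, ⟨i'⟩⟩ := hU'
    have h0 : q ▷ U = 0 := by rw [← cancel_mono e.hom, h, Limits.zero_comp]
    apply hq.ne_zero
    have hf : (tensorRightEquivalence i i').functor.map q =
      (tensorRightEquivalence i i').functor.map 0 := by
        refine h0.trans (hom_ext ?_)
        exact (TensorProduct.map_zero_left _).symm
    exact (tensorRightEquivalence i i').functor.map_injective hf)
  rwa [finrank_tensor, hU, mul_one] at this

/-- A map from the kernel of a minimal projective to a one-dimensional module which factors through
a projective module vanishes. -/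
theorem eq_zero_of_mem_projectiveMorphisms [FiniteDimensional k H] {P S K T : FinMod k H}
    {ι : K ⟶ P} {π : P ⟶ S}
    (hS : Module.finrank k S.V = 1) (hT : Module.finrank k T.V = 1) (hπ : IsMinimalProjective π)
    (h : IsSES ι π) {φ : K ⟶ T} (hφ : φ ∈ projectiveMorphisms K T) : φ = 0 := by
  by_contra h0
  obtain ⟨Q, hQ, f, g, rfl⟩ := hφ
  obtain ⟨P₁, π₁, h₁⟩ := exists_isMinimalProjective hT
  obtain ⟨g', rfl⟩ := exists_lift_of_projective hQ g π₁ (lin_surjective_of_ne_zero hT h₁.ne_zero)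
  -- Essentiality makes `K` surject onto `P₁`, but `K` has dimension one less than `P`, which is at
  -- most that of `P₁`.
  have hsurj := h₁.surjective hT (f ≫ g') (by rwa [Category.assoc])
  have h2 := LinearMap.finrank_le_finrank_of_surjective hsurj
  have h3 := h.finrank_eq
  have h4 := hπ.finrank_le hS hT h₁
  omega

end Hopf

end FinMod

/-! ### Consequences of a stable equivalence -/

section Stable

variable {C : Type u} [Category.{v} C] [Preadditive C] [Limits.HasBinaryBiproducts C]
  [Limits.HasZeroObject C]
variable {D : Type u} [Category.{v} D] [Preadditive D] [Limits.HasBinaryBiproducts D]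
  [Limits.HasZeroObject D]

theorem quotient_functor_map_eq_iff {X Y : C} (f g : X ⟶ Y) :
    (CategoryTheory.Quotient.functor (stableRel C)).map f =
      (CategoryTheory.Quotient.functor (stableRel C)).map g ↔
    f - g ∈ projectiveMorphisms X Y :=
  CategoryTheory.Quotient.functor_map_eq_iff _ f g

namespace InducesStableEquivalence

variable {F : C ⥤ D} [F.Additive]

theorem exists_sub_mem (hF : InducesStableEquivalence F) {X Y : C} (g : F.obj X ⟶ F.obj Y) :
    ∃ f : X ⟶ Y, g - F.map f ∈ projectiveMorphisms (F.obj X) (F.obj Y) := by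
  obtain ⟨hP, _⟩ := hF
  obtain ⟨f, hf⟩ := (stableFunctor F hP).map_surjective
    (X := (CategoryTheory.Quotient.functor (stableRel C)).obj X)
    (Y := (CategoryTheory.Quotient.functor (stableRel C)).obj Y)
    ((CategoryTheory.Quotient.functor (stableRel D)).map g)
  obtain ⟨f, rfl⟩ := (CategoryTheory.Quotient.functor (stableRel C)).map_surjective f
  exact ⟨f, (quotient_functor_map_eq_iff _ _).1 hf.symm⟩

theorem mem_of_map_mem (hF : InducesStableEquivalence F) {X Y : C} (f : X ⟶ Y)
    (h : F.map f ∈ projectiveMorphisms (F.obj X) (F.obj Y)) : f ∈ projectiveMorphisms X Y := by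
  obtain ⟨hP, _⟩ := hF
  have : (CategoryTheory.Quotient.functor (stableRel C)).map f =
      (CategoryTheory.Quotient.functor (stableRel C)).map 0 := by
    apply (stableFunctor F hP).map_injective
    refine (quotient_functor_map_eq_iff (F.map f) (F.map 0)).2 ?_
    rwa [F.map_zero, sub_zero]
  rw [quotient_functor_map_eq_iff, sub_zero] at this
  exact this

/-- This is the half of essential surjectivity that detects one-dimensional modules: `Y` is, up to
maps through projectives, a retract of some `F X`. -/
theorem exists_stable_retract (hF : InducesStableEquivalence F) (Y : D) :
    ∃ (X : C) (a : F.obj X ⟶ Y) (b : Y ⟶ F.obj X), b ≫ a - 𝟙 Y ∈ projectiveMorphisms Y Y := by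
  obtain ⟨hP, _⟩ := hF
  obtain ⟨⟨X⟩, ⟨e⟩⟩ := Functor.EssSurj.mem_essImage (F := stableFunctor F hP)
    ((CategoryTheory.Quotient.functor (stableRel D)).obj Y)
  obtain ⟨a, ha⟩ := (CategoryTheory.Quotient.functor (stableRel D)).map_surjective
    (X := F.obj X) (Y := Y) e.hom
  obtain ⟨b, hb⟩ := (CategoryTheory.Quotient.functor (stableRel D)).map_surjective
    (X := Y) (Y := F.obj X) e.inv
  refine ⟨X, a, b, (quotient_functor_map_eq_iff _ _).1 ?_⟩
  rw [Functor.map_comp, ha, hb]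
  exact e.inv_hom_id.trans (CategoryTheory.Functor.map_id _ _).symm

end InducesStableEquivalence

end Stable

namespace FinMod

/-! ### Exact functors between module categories -/

section Algebra

variable {k A A' : Type u} [Field k] [Ring A] [Algebra k A] [Ring A'] [Algebra k A']

theorem subsingleton_iff_id_eq_zero (X : FinMod k A) : Subsingleton X.V ↔ 𝟙 X = 0 := by
  rw [hom_eq_zero_iff]
  refine ⟨fun _ => Subsingleton.elim _ _, fun h => ⟨fun x y => ?_⟩⟩
  have e : ∀ z : X.V, z = 0 := LinearMap.congr_fun h
  rw [e x, e y]

variable (F : FinMod k A ⥤ FinMod k A')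

theorem subsingleton_map [F.Additive] {X : FinMod k A} (hX : Subsingleton X.V) :
    Subsingleton (F.obj X).V := by
  rw [subsingleton_iff_id_eq_zero] at hX ⊢
  rw [← F.map_id, hX, F.map_zero]

theorem map_lin_injective [Limits.PreservesFiniteLimits F] {X Y : FinMod k A} {f : X ⟶ Y}
    (hf : Function.Injective f.lin) : Function.Injective (F.map f).lin := by
  rw [← mono_iff_injective] at hf ⊢
  infer_instance

theorem map_lin_surjective [Limits.PreservesFiniteColimits F] {X Y : FinMod k A} {f : X ⟶ Y}
    (hf : Function.Surjective f.lin) : Function.Surjective (F.map f).lin := by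
  rw [← epi_iff_surjective] at hf ⊢
  infer_instance

theorem IsSES.map [F.Additive] [Limits.PreservesFiniteLimits F] [Limits.PreservesFiniteColimits F]
    {X Y Z : FinMod k A} {i : X ⟶ Y} {p : Y ⟶ Z} (h : IsSES i p) :
    IsSES (F.map i) (F.map p) where
  inj := map_lin_injective F h.inj
  surj := map_lin_surjective F h.surj
  exact := by
    have hz : F.map i ≫ F.map p = 0 := by rw [← F.map_comp, h.zero, F.map_zero]
    refine le_antisymm ?_ ?_
    · rintro _ ⟨x, rfl⟩
      exact LinearMap.congr_fun ((hom_eq_zero_iff _).1 hz) x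
    · have hi : Mono i := (mono_iff_injective i).2 h.inj
      have hl : Limits.IsLimit (Limits.KernelFork.ofι i h.zero) :=
        Limits.KernelFork.IsLimit.ofι i h.zero
          (fun t ht => (h.exists_lift t ht).choose)
          (fun t ht => (h.exists_lift t ht).choose_spec)
          (fun t ht m hm => by
            rw [← cancel_mono i, hm, (h.exists_lift t ht).choose_spec])
      have hl' := Limits.isLimitForkMapOfIsLimit' F h.zero hl
      -- `F.map i` is again a kernel; lifting the inclusion of the set-theoretic kernel through it
      -- provides the preimages.
      obtain ⟨l, hl⟩ := Limits.KernelFork.IsLimit.lift' hl' (subModι _ _ (ker_stable (F.map p)))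
        (hom_ext (LinearMap.ext fun x => LinearMap.mem_ker.1 (Subtype.prop x)))
      intro y hy
      exact ⟨l.lin ⟨y, hy⟩, LinearMap.congr_fun (congrArg Hom.lin hl) ⟨y, hy⟩⟩

end Algebra

/-! ### Dimension, faithfulness and partial fullness of the functor -/

section Hopf

open MonoidalCategory

variable {k H H' : Type u} [Field k] [Ring H] [HopfAlgebra k H] [Ring H'] [HopfAlgebra k H']
  (F : FinMod k H ⥤ FinMod k H') [F.Monoidal]

/-- If `T ⊗ T'` is the unit, then the dimensions of `F T` and `F T'` multiply to one. -/
theorem finrank_map_of_finrank_eq_one {T : FinMod k H} (hT : Module.finrank k T.V = 1) :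
    Module.finrank k (F.obj T).V = 1 := by
  obtain ⟨T', -, ⟨e⟩, -⟩ := exists_tensor_inverse hT
  have := finrank_eq_of_iso (Functor.Monoidal.μIso F T T' ≪≫ F.mapIso e ≪≫
    (Functor.Monoidal.εIso F).symm)
  rw [finrank_tensor, finrank_unit] at this
  exact Nat.eq_one_of_mul_eq_one_right this

/-- A nonzero map is an isomorphism, so a factorization through a projective would make `S` a
retract of it. -/
theorem eq_zero_of_mem_projectiveMorphisms_of_finrank_eq_one [IsAlgClosed k]
    [FiniteDimensional k H'] (hb' : IsBasicAlgebra k H')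
    (hss' : ¬ IsSemisimpleRing H') {S T : FinMod k H'} (hS : Module.finrank k S.V = 1)
    (hT : Module.finrank k T.V = 1) {f : S ⟶ T} (hf : f ∈ projectiveMorphisms S T) : f = 0 := by
  by_contra h0
  have := isIso_of_ne_zero hS hT h0
  obtain ⟨P, hP, i, j, rfl⟩ := hf
  exact not_projective_of_finrank_eq_one hb' hss' hS
    (Retract.projective ⟨i, j ≫ inv (i ≫ j), by rw [← Category.assoc, IsIso.hom_inv_id]⟩)

theorem exists_map_eq_of_finrank_eq_one [IsAlgClosed k] [FiniteDimensional k H']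
    {F : FinMod k H ⥤ FinMod k H'}
    [F.Additive] [F.Monoidal] (hF : InducesStableEquivalence F) (hb' : IsBasicAlgebra k H')
    (hss' : ¬ IsSemisimpleRing H') {S T : FinMod k H} (hS : Module.finrank k S.V = 1)
    (hT : Module.finrank k T.V = 1) (g : F.obj S ⟶ F.obj T) : ∃ f : S ⟶ T, F.map f = g := by
  obtain ⟨f, hf⟩ := hF.exists_sub_mem g
  exact ⟨f, (sub_eq_zero.1 (eq_zero_of_mem_projectiveMorphisms_of_finrank_eq_one hb' hss'
    (finrank_map_of_finrank_eq_one F hS) (finrank_map_of_finrank_eq_one F hT) hf)).symm⟩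

variable [Limits.PreservesFiniteLimits F] [Limits.PreservesFiniteColimits F]
variable [F.Additive] [IsAlgClosed k]

theorem finrank_map (hb : IsBasicAlgebra k H) (X : FinMod k H) :
    Module.finrank k (F.obj X).V = Module.finrank k X.V := by
  refine induction_of_isBasic hb
    (p := fun X => Module.finrank k (F.obj X).V = Module.finrank k X.V)
    (fun X hX => ?_) (fun {X Y χ i q} h hX => ?_) X
  · have := subsingleton_map F hX
    rw [Module.finrank_zero_of_subsingleton, Module.finrank_zero_of_subsingleton]
  · rw [h.finrank_eq, (h.map F).finrank_eq, hX, finrank_charMod,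
      finrank_map_of_finrank_eq_one F (finrank_charMod χ)]

/-- The image of `f` is sent to zero by exactness, and `F` preserves dimension. -/
theorem map_eq_zero (hb : IsBasicAlgebra k H) {X Y : FinMod k H} {f : X ⟶ Y} (hf : F.map f = 0) :
    f = 0 := by
  let I := subMod Y _ (range_stable f)
  let ι : I ⟶ Y := subModι Y _ (range_stable f)
  have hι : Function.Injective ι.lin := Subtype.val_injective
  obtain ⟨q, hqι⟩ := exists_lift_of_injective ι hι f (Submodule.range_subtype _).ge
  have hq : Function.Surjective q.lin := by
    rintro ⟨_, x, rfl⟩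
    exact ⟨x, hι (LinearMap.congr_fun (congrArg Hom.lin hqι) x)⟩
  have hFq : F.map q = 0 := by
    have := (mono_iff_injective _).2 (map_lin_injective F hι)
    rw [← cancel_mono (F.map ι), ← F.map_comp, hqι, hf, Limits.zero_comp]
  have hs : Subsingleton (F.obj I).V := by
    have := (epi_iff_surjective _).2 (map_lin_surjective F hq)
    rw [subsingleton_iff_id_eq_zero, ← cancel_epi (F.map q), hFq]
    simp
  have h0 : Module.finrank k I.V = 0 := by
    rw [← finrank_map F hb, Module.finrank_zero_of_subsingleton]
  have := Module.finrank_zero_iff.1 h0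
  rw [← hqι, ← Category.id_comp ι, (subsingleton_iff_id_eq_zero I).1 this, Limits.zero_comp,
    Limits.comp_zero]

variable {F}

/-- Follow the map up a filtration of `X`: either it is nonzero, hence an isomorphism, on the top
factor, or it lifts to the submodule. -/
theorem exists_iso_of_hom_ne_zero (hb : IsBasicAlgebra k H) {T : FinMod k H'}
    (hT : Module.finrank k T.V = 1) (X : FinMod k H) :
    (∃ b : T ⟶ F.obj X, b ≠ 0) → ∃ S : FinMod k H, Module.finrank k S.V = 1 ∧
      Nonempty (F.obj S ≅ T) := by
  refine induction_of_isBasic hb (p := fun X => (∃ b : T ⟶ F.obj X, b ≠ 0) →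
    ∃ S : FinMod k H, Module.finrank k S.V = 1 ∧ Nonempty (F.obj S ≅ T))
    (fun X hX ⟨b, hb⟩ => ?_) (fun {X Y χ i q} h hX ⟨b, hb⟩ => ?_) X
  · have := subsingleton_map F hX
    exact (hb (hom_ext (LinearMap.ext fun x => Subsingleton.elim _ _))).elim
  · by_cases h0 : b ≫ F.map q = 0
    · obtain ⟨b', rfl⟩ := (h.map F).exists_lift b h0
      exact hX ⟨b', fun h => hb (by rw [h, Limits.zero_comp])⟩
    · have := isIso_of_ne_zero hT (finrank_map_of_finrank_eq_one F (finrank_charMod χ)) h0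
      exact ⟨charMod χ, finrank_charMod χ, ⟨(asIso (b ≫ F.map q)).symm⟩⟩

variable [FiniteDimensional k H']

theorem exists_iso_map_of_finrank_eq_one (hF : InducesStableEquivalence F)
    (hb : IsBasicAlgebra k H) (hb' : IsBasicAlgebra k H')
    (hss' : ¬ IsSemisimpleRing H') {T : FinMod k H'} (hT : Module.finrank k T.V = 1) :
    ∃ S : FinMod k H, Module.finrank k S.V = 1 ∧ Nonempty (F.obj S ≅ T) := by
  obtain ⟨X, a, b, hab⟩ := hF.exists_stable_retract T
  refine exists_iso_of_hom_ne_zero hb hT X ⟨b, fun h0 => ?_⟩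
  have h1 := eq_zero_of_mem_projectiveMorphisms_of_finrank_eq_one hb' hss' hT hT hab
  rw [h0, Limits.zero_comp, zero_sub, neg_eq_zero, ← subsingleton_iff_id_eq_zero] at h1
  rw [Module.finrank_zero_of_subsingleton] at hT
  exact zero_ne_one hT

variable [FiniteDimensional k H]

/-- Induct on `0 ⟶ X ⟶ Y ⟶ χ ⟶ 0`. A lift `f'` of the restriction of `g` to `F X` extends to `Y`
once its obstruction in `Ext¹(χ, T)` vanishes. That class is represented by `φ ≫ f'` on the kernel
`K` of the minimal projective of `χ`. -/
theorem exists_map_eq (hF : InducesStableEquivalence F)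
    (hb : IsBasicAlgebra k H) (hb' : IsBasicAlgebra k H')
    (hss' : ¬ IsSemisimpleRing H') {T : FinMod k H} (hT : Module.finrank k T.V = 1)
    (X : FinMod k H) : ∀ g : F.obj X ⟶ F.obj T, ∃ f : X ⟶ T, F.map f = g := by
  refine induction_of_isBasic hb (p := fun X => ∀ g : F.obj X ⟶ F.obj T, ∃ f : X ⟶ T, F.map f = g)
    (fun X hX g => ?_) (fun {X Y χ i q} h ih g => ?_) X
  · have := subsingleton_map F hX
    exact ⟨0, hom_ext (LinearMap.ext fun x => by
      rw [Subsingleton.elim x 0, map_zero, map_zero])⟩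
  · obtain ⟨f', hf'⟩ := ih (F.map i ≫ g)
    obtain ⟨P, π, hπ⟩ := exists_isMinimalProjective (finrank_charMod χ)
    obtain ⟨K, ι, hι⟩ := exists_isSES_of_surjective π
      (lin_surjective_of_ne_zero (finrank_charMod χ) hπ.ne_zero)
    obtain ⟨r, hr⟩ := exists_lift_of_projective hπ.projective π q h.surj
    obtain ⟨φ, hφ⟩ := h.exists_lift (ι ≫ r) (by rw [Category.assoc, hr, hι.zero])
    -- After applying `F`, this map becomes `F ι ≫ F r ≫ g`, which factors through the projective `F
    -- P`.
    have hφf : φ ≫ f' = 0 := by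
      refine eq_zero_of_mem_projectiveMorphisms (finrank_charMod χ) hT hπ hι
        (hF.mem_of_map_mem _ ⟨F.obj P, hF.1 P hπ.projective, F.map ι, F.map r ≫ g, ?_⟩)
      rw [F.map_comp, hf', ← Category.assoc, ← F.map_comp, ← Category.assoc, ← F.map_comp, hφ]
    -- `Y` is the quotient of `X ⊕ P` by the copy of `K` embedded by `(-φ, ι)`. The map `(f', 0)`
    -- kills it because `φ ≫ f' = 0`, so it descends to the extension `f₀`.
    let s : directSum X P ⟶ Y := mkHom (i.lin.coprod r.lin) (fun a x => by
      change i.lin (X.ρ a x.1) + r.lin (P.ρ a x.2) = Y.ρ a (i.lin x.1 + r.lin x.2)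
      rw [lin_ρ, lin_ρ, map_add])
    let t : directSum X P ⟶ T := mkHom (f'.lin ∘ₗ LinearMap.fst k X.V P.V) (fun a x =>
      lin_ρ f' a x.1)
    have hs : Function.Surjective s.lin := by
      intro y
      obtain ⟨p, hp⟩ := lin_surjective_of_ne_zero (finrank_charMod χ) hπ.ne_zero (q.lin y)
      have : y - r.lin p ∈ LinearMap.ker q.lin := by
        rw [LinearMap.mem_ker, map_sub, sub_eq_zero, ← hp, ← hr]
        rfl
      rw [← h.exact] at this
      obtain ⟨x, hx⟩ := this
      refine ⟨(x, p), ?_⟩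
      change i.lin x + r.lin p = y
      rw [hx, sub_add_cancel]
    have hst : LinearMap.ker s.lin ≤ LinearMap.ker t.lin := by
      rintro ⟨x, p⟩ hxp
      have hxp : i.lin x + r.lin p = 0 := hxp
      have hp : p ∈ LinearMap.ker π.lin := by
        have h1 := congrArg q.lin hxp
        rw [map_add, map_zero, ← comp_apply, h.zero, ← comp_apply, hr] at h1
        exact (zero_add _).symm.trans h1
      rw [← hι.exact] at hp
      obtain ⟨y, rfl⟩ := hp
      have hx : x = -φ.lin y := by
        apply h.inj
        rw [map_neg, ← comp_apply, hφ, ← add_eq_zero_iff_eq_neg]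
        exact hxp
      change f'.lin x = 0
      rw [hx, map_neg, ← comp_apply, hφf]
      exact neg_zero
    obtain ⟨f₀, hf₀⟩ := exists_factor_of_surjective s hs t hst
    have hif : i ≫ f₀ = f' := hom_ext (LinearMap.ext fun x => by
      have h1 := LinearMap.congr_fun (congrArg Hom.lin hf₀) (x, 0)
      have h2 : s.lin (x, 0) = i.lin x := by
        change i.lin x + r.lin 0 = i.lin x
        rw [map_zero, add_zero]
      rw [comp_apply, ← h2]
      exact h1)
    -- The error `g - F f₀` vanishes on `F X`, so it comes from a map between one-dimensional
    -- modules, where `F` is full.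
    obtain ⟨g₁, hg₁⟩ := (h.map F).exists_desc (g - F.map f₀) (by
      rw [Preadditive.comp_sub, ← F.map_comp, hif, hf', sub_self])
    obtain ⟨f₁, rfl⟩ := exists_map_eq_of_finrank_eq_one hF hb' hss' (finrank_charMod χ) hT g₁
    exact ⟨q ≫ f₁ + f₀, by rw [F.map_add, F.map_comp, hg₁, sub_add_cancel]⟩

end Hopf

end FinMod

namespace FinMod

/-! ### Recognizing the regular module -/

section Algebra

variable {k A : Type u} [Field k] [Ring A] [Algebra k A] [FiniteDimensional k A]

theorem fromReg_add (X : FinMod k A) (x y : X.V) : fromReg X (x + y) = fromReg X x + fromReg X y :=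
  reg_hom_ext (by rw [add_lin, LinearMap.add_apply, fromReg_one, fromReg_one, fromReg_one])

theorem fromReg_smul (X : FinMod k A) (c : k) (x : X.V) : fromReg X (c • x) = c • fromReg X x :=
  reg_hom_ext (by rw [smul_lin, LinearMap.smul_apply, fromReg_one, fromReg_one])

theorem fromReg_lin_one {X : FinMod k A} (f : reg k A ⟶ X) :
    fromReg X (f.lin (regEquiv k A 1)) = f :=
  reg_hom_ext (fromReg_one _ _)

theorem fromReg_reg_one : fromReg (reg k A) (regEquiv k A 1) = 𝟙 _ :=
  fromReg_lin_one (𝟙 (reg k A))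

/-- Distinct characters are linearly independent by Dedekind. -/
theorem finite_characters (k A : Type u) [Field k] [Ring A] [Algebra k A]
    [FiniteDimensional k A] : Finite (A →ₐ[k] k) := by
  have h : LinearIndependent k fun χ : A →ₐ[k] k => χ.toLinearMap := by
    refine LinearIndependent.of_comp (LinearMap.ltoFun k A k k) ?_
    exact (linearIndependent_monoidHom A k).comp (fun χ : A →ₐ[k] k => (χ : A →* k))
      fun χ ψ e => AlgHom.ext fun a => DFunLike.congr_fun e a
  exact h.finite_of_isNoetherian

/-- A projective module over a basic algebra is isomorphic to the regular module if each
one-dimensional module is a quotient of it in exactly one way up to scalars. -/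
theorem exists_bijective_fromReg [IsAlgClosed k] (hb : IsBasicAlgebra k A) {X : FinMod k A}
    (hX : Projective X)
    (h : ∀ χ : A →ₐ[k] k, ∃ p : X ⟶ charMod χ, p ≠ 0 ∧ ∀ g : X ⟶ charMod χ, ∃ c : k, g = c • p) :
    ∃ e : X.V, Function.Bijective (fromReg X e).lin := by
  choose p hp hpg using h
  have := finite_characters k A
  have : Infinite k := IsAlgClosed.instInfinite
  -- Over an infinite field finitely many proper subspaces do not cover `X`, so `e` can avoid the
  -- kernels of all the `p χ`.
  obtain ⟨e, he⟩ := Module.Dual.exists_forall_ne_zero_of_forall_exists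
    (K := k) (M := X.V) (fun χ => (p χ).lin) (fun χ => by
      by_contra! hc
      exact hp χ (hom_ext (LinearMap.ext hc)))
  have hsurj : Function.Surjective (fromReg X e).lin := by
    by_contra hs
    let Q := quotMod X _ (range_stable (fromReg X e))
    let π : X ⟶ Q := quotModπ X _ (range_stable (fromReg X e))
    have hπ : Function.Surjective π.lin := Submodule.mkQ_surjective _
    have hQ : Nontrivial Q.V := Submodule.Quotient.nontrivial_iff.2
      (fun h => hs (LinearMap.range_eq_top.1 h))
    -- A character of the cokernel pulls back to a multiple of `p χ` that kills `e`, so the multiple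
    -- is zero.
    obtain ⟨χ, f, hf⟩ := exists_hom_charMod_ne_zero hb Q
    obtain ⟨c, hc⟩ := hpg χ (π ≫ f)
    have h0 : π.lin e = 0 :=
      (Submodule.Quotient.mk_eq_zero _).2 ⟨regEquiv k A 1, fromReg_one X e⟩
    have h1 := LinearMap.congr_fun (congrArg Hom.lin hc) e
    rw [comp_apply, h0, map_zero] at h1
    have hc0 : c = 0 := (mul_eq_zero.1 h1.symm).resolve_right (he χ)
    have := (epi_iff_surjective π).2 hπ
    exact hf (by rw [← cancel_epi π, hc, hc0, zero_smul, Limits.comp_zero])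
  refine ⟨e, ?_, hsurj⟩
  obtain ⟨s, hs⟩ := exists_lift_of_projective hX (𝟙 X) (fromReg X e) hsurj
  obtain ⟨K, ι, hι⟩ := exists_isSES_of_surjective _ hsurj
  obtain ⟨r, hr⟩ := hι.exists_lift (𝟙 _ - fromReg X e ≫ s) (by
    rw [Preadditive.sub_comp, Category.assoc, hs]
    simp)
  have hιm := (mono_iff_injective ι).2 hι.inj
  have hιr : ι ≫ r = 𝟙 K := by
    rw [← cancel_mono ι, Category.assoc, hr, Preadditive.comp_sub, ← Category.assoc, hι.zero]
    simp
  rcases subsingleton_or_nontrivial K.V with hK | hK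
  · rw [← LinearMap.ker_eq_bot, ← hι.exact, LinearMap.range_eq_bot]
    exact LinearMap.ext fun x => by rw [Subsingleton.elim x 0, map_zero, map_zero]
  · obtain ⟨χ, q, hq⟩ := exists_hom_charMod_ne_zero hb K
    -- Maps from the regular module to a character form a line, here spanned by `fromReg X e ≫ p χ`,
    -- which vanishes on the summand `K`.
    have hc : ∃ c : k, r ≫ q = c • (fromReg X e ≫ p χ) := by
      let a : k := (r ≫ q).lin (regEquiv k A 1)
      let b : k := (p χ).lin e
      refine ⟨a / b, reg_hom_ext ?_⟩
      rw [smul_lin, LinearMap.smul_apply, comp_apply _ (p χ), fromReg_one]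
      exact (div_mul_cancel₀ a (he χ)).symm
    obtain ⟨c, hc⟩ := hc
    exfalso
    apply hq
    rw [← Category.id_comp q, ← hιr, Category.assoc, hc, Linear.comp_smul, ← Category.assoc,
      hι.zero, Limits.zero_comp, smul_zero]

end Algebra

section Hopf

variable {k H H' : Type u} [Field k] [IsAlgClosed k] [Ring H] [HopfAlgebra k H] [Ring H']
  [HopfAlgebra k H'] [FiniteDimensional k H] [FiniteDimensional k H']
  {F : FinMod k H ⥤ FinMod k H'} [F.Additive] [F.Linear k] [F.Monoidal]
  [Limits.PreservesFiniteLimits F] [Limits.PreservesFiniteColimits F]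

theorem exists_bijective_fromReg_map_reg (hF : InducesStableEquivalence F)
    (hb : IsBasicAlgebra k H) (hb' : IsBasicAlgebra k H') (hss' : ¬ IsSemisimpleRing H') :
    ∃ e : (F.obj (reg k H)).V, Function.Bijective (fromReg (F.obj (reg k H)) e).lin := by
  refine exists_bijective_fromReg hb' (hF.1 _ inferInstance) fun χ => ?_
  obtain ⟨S, hS, ⟨i⟩⟩ := exists_iso_map_of_finrank_eq_one hF hb hb' hss' (finrank_charMod χ)
  obtain ⟨s, hs, hs'⟩ := finrank_eq_one_iff'.1 hS
  -- Maps from the regular module to `S` form a line, which `F` carries injectively onto the maps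
  -- from `F(H)` to `F S`.
  refine ⟨F.map (fromReg S s) ≫ i.hom, fun h => hs ?_, fun g => ?_⟩
  · have h0 : F.map (fromReg S s) = 0 := by
      rw [← cancel_mono i.hom, h, Limits.zero_comp]
    rw [← fromReg_one S s, map_eq_zero F hb h0]
    rfl
  · obtain ⟨f, hf⟩ := exists_map_eq hF hb hb' hss' hS _ (g ≫ i.inv)
    obtain ⟨c, hc⟩ := hs' (f.lin (regEquiv k H 1))
    refine ⟨c, ?_⟩
    rw [← Linear.smul_comp, ← F.map_smul, ← fromReg_smul, hc, fromReg_lin_one, hf, Category.assoc,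
      i.inv_hom_id, Category.comp_id]

end Hopf

end FinMod

namespace FinMod

/-! ### Natural endomorphisms of tensor products of modules -/

section Regular

variable {k H : Type u} [Field k] [Ring H] [Bialgebra k H] [FiniteDimensional k H]

theorem map_fromReg (X Y : FinMod k H) (x : X.V) (y : Y.V) (t : H ⊗[k] H) :
    TensorProduct.map (fromReg X x).lin (fromReg Y y).lin
      (TensorProduct.map (regEquiv k H).toLinearMap (regEquiv k H).toLinearMap t) =
    pairAction X Y t (x ⊗ₜ y) := by
  induction t with
  | zero => simp
  | add s t hs ht => simp only [map_add, LinearMap.add_apply, hs, ht]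
  | tmul a b => rfl

theorem pairAction_reg (t : H ⊗[k] H) :
    pairAction (reg k H) (reg k H) t (regEquiv k H 1 ⊗ₜ regEquiv k H 1) =
      TensorProduct.congr (regEquiv k H) (regEquiv k H) t := by
  induction t with
  | zero => simp
  | add s t hs ht => simp only [map_add, LinearMap.add_apply, hs, ht]
  | tmul a b => rw [pairAction_tmul, reg_ρ_one, reg_ρ_one, TensorProduct.congr_tmul]

/-- An element is recovered from its value at `1 ⊗ 1`, so identities in `H ⊗ H` may be checked on
operators. -/
theorem pairAction_reg_injective :
    Function.Injective (pairAction (reg k H) (reg k H)) := fun s t h =>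
  (TensorProduct.congr (regEquiv k H) (regEquiv k H)).injective (by
    rw [← pairAction_reg, h, pairAction_reg])

theorem tripleRight_reg (t : H ⊗[k] (H ⊗[k] H)) :
    tripleRight (reg k H) (reg k H) (reg k H) t
      (regEquiv k H 1 ⊗ₜ (regEquiv k H 1 ⊗ₜ regEquiv k H 1)) =
      TensorProduct.congr (regEquiv k H) (TensorProduct.congr (regEquiv k H) (regEquiv k H)) t := by
  induction t with
  | zero => simp
  | add s t hs ht => simp only [map_add, LinearMap.add_apply, hs, ht]
  | tmul a s =>
    rw [TensorProduct.congr_tmul, ← pairAction_reg, ← reg_ρ_one a]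
    rfl

theorem tripleRight_reg_injective :
    Function.Injective (tripleRight (reg k H) (reg k H) (reg k H)) := fun s t h =>
  (TensorProduct.congr (regEquiv k H)
    (TensorProduct.congr (regEquiv k H) (regEquiv k H))).injective (by
      rw [← tripleRight_reg, h, tripleRight_reg])

/-- A natural family of linear endomorphisms of the tensor products `X ⊗ Y` is the action of an
element of `H ⊗ H`. -/
theorem exists_pairAction_eq (n : ∀ X Y : FinMod k H, Module.End k (X.V ⊗[k] Y.V))
    (hn : ∀ {X X' Y Y' : FinMod k H} (f : X ⟶ X') (g : Y ⟶ Y'),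
      TensorProduct.map f.lin g.lin ∘ₗ n X Y = n X' Y' ∘ₗ TensorProduct.map f.lin g.lin) :
    ∃ t : H ⊗[k] H, ∀ X Y, n X Y = pairAction X Y t := by
  obtain ⟨t, ht⟩ := (TensorProduct.congr (regEquiv k H) (regEquiv k H)).surjective
    (n (reg k H) (reg k H) (regEquiv k H 1 ⊗ₜ regEquiv k H 1))
  refine ⟨t, fun X Y => TensorProduct.ext' fun x y => ?_⟩
  rw [← map_fromReg]
  have h := LinearMap.congr_fun (hn (fromReg X x) (fromReg Y y))
    (regEquiv k H 1 ⊗ₜ regEquiv k H 1)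
  rw [LinearMap.comp_apply, LinearMap.comp_apply, ← ht, TensorProduct.map_tmul, fromReg_one,
    fromReg_one] at h
  exact h.symm

end Regular

section LinearAlgebra

variable {k M N N' P Q R M' Q' : Type*} [CommSemiring k] [AddCommMonoid M] [Module k M]
  [AddCommMonoid N] [Module k N] [AddCommMonoid N'] [Module k N'] [AddCommMonoid P] [Module k P]
  [AddCommMonoid Q] [Module k Q] [AddCommMonoid R] [Module k R] [AddCommMonoid M'] [Module k M']
  [AddCommMonoid Q'] [Module k Q']

/-- Applied to the defining square of the transported tensorator, this carries it past a third
tensor factor in `tensorator_assoc`. -/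
theorem map_left_eq (f : M →ₗ[k] N) (g : N →ₗ[k] P) (f' : M →ₗ[k] N') (g' : N' →ₗ[k] P)
    (h : Q →ₗ[k] R) (e : ∀ m, g (f m) = g' (f' m)) (t : M ⊗[k] Q) :
    TensorProduct.map g h (TensorProduct.map f LinearMap.id t) =
      TensorProduct.map g' LinearMap.id (TensorProduct.map f' h t) := by
  induction t with
  | zero => simp
  | add s t hs ht => simp only [map_add, hs, ht]
  | tmul m q => simp [e]

theorem map_right_eq (f : M →ₗ[k] N) (g : N →ₗ[k] P) (f' : M →ₗ[k] N') (g' : N' →ₗ[k] P)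
    (h : Q →ₗ[k] R) (e : ∀ m, g (f m) = g' (f' m)) (t : Q ⊗[k] M) :
    TensorProduct.map h g (TensorProduct.map LinearMap.id f t) =
      TensorProduct.map LinearMap.id g' (TensorProduct.map h f' t) := by
  induction t with
  | zero => simp
  | add s t hs ht => simp only [map_add, hs, ht]
  | tmul m q => simp [e]

theorem assoc_map (f : M →ₗ[k] M') (g : N →ₗ[k] N') (h : Q →ₗ[k] Q') (t : (M ⊗[k] N) ⊗[k] Q) :
    TensorProduct.assoc k M' N' Q' (TensorProduct.map (TensorProduct.map f g) h t) =
      TensorProduct.map f (TensorProduct.map g h) (TensorProduct.assoc k M N Q t) := by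
  induction t with
  | zero => simp
  | add s t hs ht => simp only [map_add, hs, ht]
  | tmul s q =>
    induction s with
    | zero => simp
    | add s t hs ht => simp only [TensorProduct.add_tmul, map_add, hs, ht]
    | tmul m n => rfl

end LinearAlgebra

/-! ### Reconstruction from a fibre functor -/

section Fiber

variable {k H H' : Type u} [Field k] [Ring H] [HopfAlgebra k H] [Ring H'] [HopfAlgebra k H']

/-- A natural isomorphism between the forgetful functor of `H` and the composition of `F` with the
forgetful functor of `H'`. -/
structure FiberIso (F : FinMod k H ⥤ FinMod k H') where
  /-- the components -/
  θ : ∀ X, X.V ≃ₗ[k] (F.obj X).V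
  natural : ∀ {X Y : FinMod k H} (f : X ⟶ Y) (x : X.V), (F.map f).lin (θ X x) = θ Y (f.lin x)

section Monoidal

variable (F : FinMod k H ⥤ FinMod k H') [F.Monoidal]

/-- The tensorator of a monoidal functor, as a linear equivalence. -/
def muEquiv (X Y : FinMod k H) :
    (F.obj X).V ⊗[k] (F.obj Y).V ≃ₗ[k] (F.obj (tensor X Y)).V :=
  linEquiv (X := tensor (F.obj X) (F.obj Y)) (Functor.Monoidal.μIso F X Y)

/-- The image of `1` under the unit constraint of a monoidal functor. -/
def epsOne : (F.obj (trivial k H)).V :=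
  (Functor.Monoidal.εIso F).hom.lin (1 : k)

theorem epsOne_ne_zero : epsOne F ≠ 0 := fun h =>
  one_ne_zero (α := k) ((bijective_lin (Functor.Monoidal.εIso F)).1 (h.trans (map_zero _).symm))

theorem ρ_epsOne (a : H') :
    (F.obj (trivial k H)).ρ a (epsOne F) = Coalgebra.counit (R := k) a • epsOne F := by
  refine (lin_ρ (Functor.Monoidal.εIso F).hom a (1 : k)).symm.trans ?_
  refine Eq.trans ?_ (map_smul (Functor.Monoidal.εIso F).hom.lin _ _)
  rfl

theorem muEquiv_natural {X X' Y Y' : FinMod k H} (f : X ⟶ X') (g : Y ⟶ Y')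
    (t : (F.obj X).V ⊗[k] (F.obj Y).V) :
    (F.map (tensorMap f g)).lin (muEquiv F X Y t) =
      muEquiv F X' Y' (TensorProduct.map (F.map f).lin (F.map g).lin t) :=
  (LinearMap.congr_fun (congrArg Hom.lin (Functor.LaxMonoidal.μ_natural F f g)) t).symm

theorem muEquiv_ρ (X Y : FinMod k H) (a : H') (t : (F.obj X).V ⊗[k] (F.obj Y).V) :
    muEquiv F X Y (pairAction (F.obj X) (F.obj Y) (Coalgebra.comul a) t) =
      (F.obj (tensor X Y)).ρ a (muEquiv F X Y t) :=
  lin_ρ (Functor.Monoidal.μIso F X Y).hom a t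

theorem muEquiv_assoc (X Y Z : FinMod k H)
    (t : ((F.obj X).V ⊗[k] (F.obj Y).V) ⊗[k] (F.obj Z).V) :
    (F.map (associator X Y Z).hom).lin (muEquiv F (tensor X Y) Z
      (TensorProduct.map (muEquiv F X Y).toLinearMap LinearMap.id t)) =
    muEquiv F X (tensor Y Z) (TensorProduct.map LinearMap.id (muEquiv F Y Z).toLinearMap
      (TensorProduct.assoc k _ _ _ t)) :=
  LinearMap.congr_fun (congrArg Hom.lin (Functor.LaxMonoidal.associativity F X Y Z)) t

theorem muEquiv_epsOne_left (X : FinMod k H) (y : (F.obj X).V) :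
    (F.map (leftUnitor X).hom).lin (muEquiv F (trivial k H) X (epsOne F ⊗ₜ y)) = y :=
  (LinearMap.congr_fun (congrArg Hom.lin (Functor.LaxMonoidal.left_unitality F X))
    ((1 : k) ⊗ₜ y)).symm.trans (one_smul k y)

theorem muEquiv_epsOne_right (X : FinMod k H) (y : (F.obj X).V) :
    (F.map (rightUnitor X).hom).lin (muEquiv F X (trivial k H) (y ⊗ₜ epsOne F)) = y :=
  (LinearMap.congr_fun (congrArg Hom.lin (Functor.LaxMonoidal.right_unitality F X))
    (y ⊗ₜ (1 : k))).symm.trans (one_smul k y)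

end Monoidal

namespace FiberIso

variable {F : FinMod k H ⥤ FinMod k H'} (Θ : FiberIso F)

/-- The multiple of a natural isomorphism by a nonzero scalar. -/
def scale (c : k) (hc : c ≠ 0) : FiberIso F where
  θ X := (LinearEquiv.smulOfNeZero k X.V c hc).trans (Θ.θ X)
  natural f x := by
    change (F.map f).lin (Θ.θ _ (c • x)) = Θ.θ _ (c • f.lin x)
    rw [Θ.natural, map_smul]

theorem scale_θ (c : k) (hc : c ≠ 0) (X : FinMod k H) (x : X.V) :
    (Θ.scale c hc).θ X x = c • Θ.θ X x :=
  map_smul (Θ.θ X) c x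

theorem pairAction_map (σ : H ≃ₐ[k] H')
    (hσ : ∀ X a x, (F.obj X).ρ (σ a) (Θ.θ X x) = Θ.θ X (X.ρ a x)) (X Y : FinMod k H)
    (s : H ⊗[k] H) (t : X.V ⊗[k] Y.V) :
    pairAction (F.obj X) (F.obj Y) (Algebra.TensorProduct.map σ.toAlgHom σ.toAlgHom s)
      (TensorProduct.map (Θ.θ X).toLinearMap (Θ.θ Y).toLinearMap t) =
    TensorProduct.map (Θ.θ X).toLinearMap (Θ.θ Y).toLinearMap (pairAction X Y s t) := by
  induction s with
  | zero => simp
  | add s s' h h' => simp only [map_add, LinearMap.add_apply, h, h']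
  | tmul b c =>
    induction t with
    | zero => simp
    | add s t hs ht => simp only [map_add, hs, ht]
    | tmul x y => exact congrArg₂ (fun v w => v ⊗ₜ[k] w) (hσ X b x) (hσ Y c y)

section Transport

variable [F.Monoidal]

/-- The tensorator of `F`, transported along `Θ`. -/
def tensorator (X Y : FinMod k H) : X.V ⊗[k] Y.V ≃ₗ[k] X.V ⊗[k] Y.V :=
  (TensorProduct.congr (Θ.θ X) (Θ.θ Y)).trans ((muEquiv F X Y).trans (Θ.θ (tensor X Y)).symm)

/-- The component at a tensor product. -/
def tensorθ (X Y : FinMod k H) : X.V ⊗[k] Y.V ≃ₗ[k] (F.obj (tensor X Y)).V :=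
  Θ.θ (tensor X Y)

theorem θ_tensorator (X Y : FinMod k H) (t : X.V ⊗[k] Y.V) :
    Θ.θ (tensor X Y) (Θ.tensorator X Y t) =
      muEquiv F X Y (TensorProduct.map (Θ.θ X).toLinearMap (Θ.θ Y).toLinearMap t) :=
  (Θ.θ (tensor X Y)).apply_symm_apply _

theorem tensorator_natural {X X' Y Y' : FinMod k H} (f : X ⟶ X') (g : Y ⟶ Y')
    (t : X.V ⊗[k] Y.V) :
    TensorProduct.map f.lin g.lin (Θ.tensorator X Y t) =
      Θ.tensorator X' Y' (TensorProduct.map f.lin g.lin t) := by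
  apply (Θ.θ (tensor X' Y')).injective
  refine (Θ.natural (tensorMap f g) _).symm.trans ?_
  rw [θ_tensorator, θ_tensorator, muEquiv_natural]
  congr 1
  induction t with
  | zero => simp
  | add s t hs ht => simp only [map_add, hs, ht]
  | tmul x y =>
    simp only [TensorProduct.map_tmul, LinearEquiv.coe_coe]
    rw [Θ.natural, Θ.natural]

theorem tensorator_assoc (X Y Z : FinMod k H) (t : (X.V ⊗[k] Y.V) ⊗[k] Z.V) :
    TensorProduct.assoc k X.V Y.V Z.V (Θ.tensorator (tensor X Y) Z
      (TensorProduct.map (Θ.tensorator X Y).toLinearMap LinearMap.id t)) =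
    Θ.tensorator X (tensor Y Z) (TensorProduct.map LinearMap.id
      (Θ.tensorator Y Z).toLinearMap (TensorProduct.assoc k X.V Y.V Z.V t)) := by
  apply (Θ.θ (tensor X (tensor Y Z))).injective
  refine (Θ.natural (associator X Y Z).hom _).symm.trans ?_
  refine (congrArg _ (θ_tensorator Θ (tensor X Y) Z _)).trans
    (Eq.trans ?_ (θ_tensorator Θ X (tensor Y Z) _).symm)
  have h₁ := map_left_eq (Θ.tensorator X Y).toLinearMap (Θ.tensorθ X Y).toLinearMap
    (TensorProduct.map (Θ.θ X).toLinearMap (Θ.θ Y).toLinearMap) (muEquiv F X Y).toLinearMap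
    (Θ.θ Z).toLinearMap (θ_tensorator Θ X Y) t
  have h₂ := map_right_eq (Θ.tensorator Y Z).toLinearMap (Θ.tensorθ Y Z).toLinearMap
    (TensorProduct.map (Θ.θ Y).toLinearMap (Θ.θ Z).toLinearMap) (muEquiv F Y Z).toLinearMap
    (Θ.θ X).toLinearMap (θ_tensorator Θ Y Z) (TensorProduct.assoc k X.V Y.V Z.V t)
  refine Eq.trans (congrArg _ (congrArg _ h₁)) ((muEquiv_assoc F X Y Z _).trans (congrArg _ ?_))
  rw [assoc_map]
  exact h₂.symm

theorem tensorator_unit_left (hΘ : Θ.θ (trivial k H) (1 : k) = epsOne F) (X : FinMod k H)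
    (x : X.V) : TensorProduct.lid k X.V (Θ.tensorator (trivial k H) X ((1 : k) ⊗ₜ x)) = x := by
  apply (Θ.θ X).injective
  refine (Θ.natural (leftUnitor X).hom _).symm.trans ?_
  rw [θ_tensorator]
  refine Eq.trans ?_ (muEquiv_epsOne_left F X (Θ.θ X x))
  rw [← hΘ]
  rfl

theorem tensorator_unit_right (hΘ : Θ.θ (trivial k H) (1 : k) = epsOne F) (X : FinMod k H)
    (x : X.V) : TensorProduct.rid k X.V (Θ.tensorator X (trivial k H) (x ⊗ₜ (1 : k))) = x := by
  apply (Θ.θ X).injective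
  refine (Θ.natural (rightUnitor X).hom _).symm.trans ?_
  rw [θ_tensorator]
  refine Eq.trans ?_ (muEquiv_epsOne_right F X (Θ.θ X x))
  rw [← hΘ]
  rfl

/-- This is the `H'`-linearity of the tensorator of `F`: `a` acts on the source through the
comultiplication of `H'` pulled back along `σ`, and on the target through that of `H`. -/
theorem tensorator_ρ (σ : H ≃ₐ[k] H')
    (hσ : ∀ X a x, (F.obj X).ρ (σ a) (Θ.θ X x) = Θ.θ X (X.ρ a x)) (X Y : FinMod k H) (a : H)
    (s : H ⊗[k] H)
    (hs : Algebra.TensorProduct.map σ.toAlgHom σ.toAlgHom s = Coalgebra.comul (σ a))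
    (t : X.V ⊗[k] Y.V) :
    Θ.tensorator X Y (pairAction X Y s t) =
      pairAction X Y (Coalgebra.comul a) (Θ.tensorator X Y t) := by
  apply (Θ.θ (tensor X Y)).injective
  refine Eq.trans ?_ (hσ (tensor X Y) a (Θ.tensorator X Y t))
  rw [θ_tensorator, θ_tensorator, ← muEquiv_ρ, ← hs, Θ.pairAction_map σ hσ]

end Transport

end FiberIso

end Fiber

end FinMod

namespace FinMod

/-! ### The twist and the algebra isomorphism -/

section Twist

variable {k H : Type u} [Field k] [Ring H] [Bialgebra k H]

/-- The conditions on a twist, in terms of its inverse. -/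
theorem isTwist_of_inv (J : (H ⊗[k] H)ˣ)
    (hl : TensorProduct.lid k H (Coalgebra.counit.rTensor H J⁻¹.1) = 1)
    (hr : TensorProduct.rid k H (Coalgebra.counit.lTensor H J⁻¹.1) = 1)
    (hc : TensorProduct.assoc k H H H (Coalgebra.comul.rTensor H J⁻¹.1 * (J⁻¹.1 ⊗ₜ[k] 1)) =
      Coalgebra.comul.lTensor H J⁻¹.1 * (1 ⊗ₜ[k] J⁻¹.1)) : IsTwist k J where
  counit_left := by
    let f := ((Algebra.TensorProduct.lid k H).toAlgHom.comp
      (Algebra.TensorProduct.map (Bialgebra.counitAlgHom k H) (AlgHom.id k H)))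
    have hl : f J⁻¹.1 = 1 := hl
    have h : f J.1 * f J⁻¹.1 = 1 := by rw [← map_mul, J.mul_inv, map_one]
    rw [hl, mul_one] at h
    exact h
  counit_right := by
    let f := ((Algebra.TensorProduct.rid k k H).toAlgHom.comp
      (Algebra.TensorProduct.map (AlgHom.id k H) (Bialgebra.counitAlgHom k H)))
    have hr : f J⁻¹.1 = 1 := hr
    have h : f J.1 * f J⁻¹.1 = 1 := by rw [← map_mul, J.mul_inv, map_one]
    rw [hr, mul_one] at h
    exact h
  cocycle := by
    let α := Algebra.TensorProduct.assoc k k k H H H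
    let d₁ := Algebra.TensorProduct.map (Bialgebra.comulAlgHom k H) (AlgHom.id k H)
    let d₂ := Algebra.TensorProduct.map (AlgHom.id k H) (Bialgebra.comulAlgHom k H)
    have hc : α (d₁ J⁻¹.1 * (J⁻¹.1 ⊗ₜ[k] 1)) = d₂ J⁻¹.1 * (1 ⊗ₜ[k] J⁻¹.1) := hc
    -- Both sides of the cocycle identity are inverses of the same element, one on the left and one
    -- on the right.
    refine left_inv_eq_right_inv (a := d₂ J⁻¹.1 * (1 ⊗ₜ[k] J⁻¹.1)) ?_ ?_
    · have h : d₂ J.1 * d₂ J⁻¹.1 = 1 := by rw [← map_mul, J.mul_inv, map_one]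
      change (1 ⊗ₜ[k] J.1) * d₂ J.1 * (d₂ J⁻¹.1 * (1 ⊗ₜ[k] J⁻¹.1)) = 1
      rw [mul_assoc, ← mul_assoc (d₂ J.1), h, one_mul, Algebra.TensorProduct.tmul_mul_tmul,
        J.mul_inv, one_mul]
      rfl
    · have h : d₁ J⁻¹.1 * d₁ J.1 = 1 := by rw [← map_mul, J.inv_mul, map_one]
      rw [← hc]
      change α _ * α ((J.1 ⊗ₜ[k] 1) * d₁ J.1) = 1
      rw [← map_mul, mul_assoc, ← mul_assoc (J⁻¹.1 ⊗ₜ[k] 1), Algebra.TensorProduct.tmul_mul_tmul,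
        J.inv_mul, one_mul, ← Algebra.TensorProduct.one_def, one_mul, h, map_one]

theorem tripleLeft_tmul_one (X Y Z : FinMod k H) (s : H ⊗[k] H) :
    tripleLeft X Y Z (s ⊗ₜ 1) = TensorProduct.map (pairAction X Y s) LinearMap.id := by
  change TensorProduct.map (pairAction X Y s) (Z.ρ 1) = _
  rw [map_one]
  rfl

theorem tripleRight_one_tmul (X Y Z : FinMod k H) (s : H ⊗[k] H) :
    tripleRight X Y Z (1 ⊗ₜ s) = TensorProduct.map LinearMap.id (pairAction Y Z s) := by
  change TensorProduct.map (X.ρ 1) (pairAction Y Z s) = _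
  rw [map_one]
  rfl

end Twist

section Gauge

variable {k H H' : Type u} [Field k] [Ring H] [HopfAlgebra k H] [Ring H'] [HopfAlgebra k H']
  [FiniteDimensional k H] {F : FinMod k H ⥤ FinMod k H'}

namespace FiberIso

variable (Θ : FiberIso F)

/-- The relation `b · θ(1) = θ(T b)` on the regular module defines `T`. Naturality along `fromReg X
x` spreads it to all modules, and comparing the two actions gives multiplicativity; `σ` is the
inverse of `T`. -/
theorem exists_algEquiv [FiniteDimensional k H']
    (he : Function.Bijective (fromReg (F.obj (reg k H)) (Θ.θ _ (regEquiv k H 1))).lin) :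
    ∃ σ : H ≃ₐ[k] H', ∀ X a x, (F.obj X).ρ (σ a) (Θ.θ X x) = Θ.θ X (X.ρ a x) := by
  let T : H' ≃ₗ[k] H := ((regEquiv k H').trans (LinearEquiv.ofBijective _ he)).trans
    ((Θ.θ (reg k H)).symm.trans (regEquiv k H).symm)
  have hT : ∀ b, Θ.θ (reg k H) (regEquiv k H (T b)) =
      (F.obj (reg k H)).ρ b (Θ.θ _ (regEquiv k H 1)) := fun b =>
    (Θ.θ (reg k H)).apply_symm_apply _
  have key : ∀ X b x, (F.obj X).ρ b (Θ.θ X x) = Θ.θ X (X.ρ (T b) x) := fun X b x => by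
    conv_lhs => rw [← fromReg_one X x]
    rw [← Θ.natural, ← lin_ρ, ← hT, Θ.natural, fromReg_apply]
  have inj : ∀ a b : H, Θ.θ (reg k H) (regEquiv k H a) = Θ.θ (reg k H) (regEquiv k H b) → a = b :=
    fun a b h => (regEquiv k H).injective ((Θ.θ _).injective h)
  have h1 : T 1 = 1 := inj _ _ (by rw [hT, map_one]; rfl)
  have hmul : ∀ a b, T (a * b) = T a * T b := fun a b => inj _ _ (by
    rw [hT, map_mul, Module.End.mul_apply, ← hT, key, reg_ρ])
  let τ : H' ≃ₐ[k] H := AlgEquiv.ofLinearEquiv T h1 hmul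
  exact ⟨τ.symm, fun X a x => by
    rw [key]
    exact congrArg (fun c => Θ.θ X (X.ρ c x)) (τ.apply_symm_apply a)⟩

variable [F.Monoidal]

/-- The tensorator and its inverse are both natural, so both are actions of elements of `H ⊗ H`. The
tensorator itself is `J⁻¹`, not `J`. -/
theorem exists_unit : ∃ J : (H ⊗[k] H)ˣ, ∀ X Y,
    (Θ.tensorator X Y).toLinearMap = pairAction X Y J⁻¹.1 := by
  obtain ⟨s, hs⟩ := exists_pairAction_eq (fun X Y => (Θ.tensorator X Y).toLinearMap)
    (fun f g => LinearMap.ext (Θ.tensorator_natural f g))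
  obtain ⟨t, ht⟩ := exists_pairAction_eq (fun X Y => (Θ.tensorator X Y).symm.toLinearMap)
    (fun {X X' Y Y'} f g => LinearMap.ext fun v => (Θ.tensorator X' Y').injective (by
      simp only [LinearMap.comp_apply, LinearEquiv.coe_coe]
      rw [← Θ.tensorator_natural, LinearEquiv.apply_symm_apply, LinearEquiv.apply_symm_apply]))
  refine ⟨⟨t, s, pairAction_reg_injective ?_, pairAction_reg_injective ?_⟩, hs⟩
  · rw [map_mul, map_one, ← hs, ← ht]
    exact LinearMap.ext (Θ.tensorator _ _).symm_apply_apply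
  · rw [map_mul, map_one, ← hs, ← ht]
    exact LinearMap.ext (Θ.tensorator _ _).apply_symm_apply

/-- The associativity axiom of `F`, evaluated on regular modules. The inner tensorator is applied
first, hence is the right-hand factor. -/
theorem assoc_eq {s : H ⊗[k] H} (hs : ∀ X Y, (Θ.tensorator X Y).toLinearMap = pairAction X Y s) :
    TensorProduct.assoc k H H H (Coalgebra.comul.rTensor H s * (s ⊗ₜ[k] 1)) =
      Coalgebra.comul.lTensor H s * (1 ⊗ₜ[k] s) := by
  apply tripleRight_reg_injective
  have key : ∀ X Y Z : FinMod k H, ∀ v,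
      tripleRight X Y Z (TensorProduct.assoc k H H H
        (Coalgebra.comul.rTensor H s * (s ⊗ₜ[k] 1))) v =
      tripleRight X Y Z (Coalgebra.comul.lTensor H s * (1 ⊗ₜ[k] s)) v := fun X Y Z v => by
    obtain ⟨v, rfl⟩ := (TensorProduct.assoc k X.V Y.V Z.V).surjective v
    refine (LinearMap.congr_fun (assoc_triple X Y Z _) v).symm.trans ?_
    have h := Θ.tensorator_assoc X Y Z v
    have e₁ := hs (tensor X Y) Z
    have e₂ := hs X (tensor Y Z)
    rw [pairAction_tensor_left] at e₁
    rw [pairAction_tensor_right] at e₂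
    rw [map_mul, map_mul, tripleLeft_tmul_one, tripleRight_one_tmul, ← hs, ← hs]
    refine (congrArg (TensorProduct.assoc k X.V Y.V Z.V) ?_).trans (h.trans ?_)
    · exact (LinearMap.congr_fun e₁ _).symm
    · exact LinearMap.congr_fun e₂ _
  exact LinearMap.ext (key _ _ _)

theorem lid_eq_one (hΘ : Θ.θ (trivial k H) (1 : k) = epsOne F) {s : H ⊗[k] H}
    (hs : ∀ X Y, (Θ.tensorator X Y).toLinearMap = pairAction X Y s) :
    TensorProduct.lid k H (Coalgebra.counit.rTensor H s) = 1 := by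
  apply (regEquiv k H).injective
  have h := Θ.tensorator_unit_left hΘ (reg k H) (regEquiv k H 1)
  rw [← reg_ρ_one]
  refine Eq.trans ?_ h
  refine Eq.trans ?_ (congrArg (TensorProduct.lid k (reg k H).V)
    (LinearMap.congr_fun (hs (trivial k H) (reg k H)) ((1 : k) ⊗ₜ regEquiv k H 1)).symm)
  refine Eq.trans ?_ (LinearMap.congr_fun (lid_pairAction (reg k H) s)
    ((1 : k) ⊗ₜ regEquiv k H 1)).symm
  exact congrArg ((reg k H).ρ _) (one_smul k (regEquiv k H 1)).symm

theorem rid_eq_one (hΘ : Θ.θ (trivial k H) (1 : k) = epsOne F) {s : H ⊗[k] H}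
    (hs : ∀ X Y, (Θ.tensorator X Y).toLinearMap = pairAction X Y s) :
    TensorProduct.rid k H (Coalgebra.counit.lTensor H s) = 1 := by
  apply (regEquiv k H).injective
  have h := Θ.tensorator_unit_right hΘ (reg k H) (regEquiv k H 1)
  rw [← reg_ρ_one]
  refine Eq.trans ?_ h
  refine Eq.trans ?_ (congrArg (TensorProduct.rid k (reg k H).V)
    (LinearMap.congr_fun (hs (reg k H) (trivial k H)) (regEquiv k H 1 ⊗ₜ (1 : k))).symm)
  refine Eq.trans ?_ (LinearMap.congr_fun (rid_pairAction (reg k H) s)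
    (regEquiv k H 1 ⊗ₜ (1 : k))).symm
  exact congrArg ((reg k H).ρ _) (one_smul k (regEquiv k H 1)).symm

theorem gaugeEquivalent (hΘ : Θ.θ (trivial k H) (1 : k) = epsOne F) (σ : H ≃ₐ[k] H')
    (hσ : ∀ X a x, (F.obj X).ρ (σ a) (Θ.θ X x) = Θ.θ X (X.ρ a x)) : GaugeEquivalent k H H' := by
  obtain ⟨J, hJ⟩ := Θ.exists_unit
  refine ⟨J, isTwist_of_inv J (Θ.lid_eq_one hΘ hJ) (Θ.rid_eq_one hΘ hJ) (Θ.assoc_eq hJ), σ,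
    fun a => ?_, fun a => ?_⟩
  · obtain ⟨s, hs⟩ := (Algebra.TensorProduct.congr σ σ).surjective (Coalgebra.comul (σ a))
    have h : J⁻¹.1 * s = Coalgebra.comul a * J⁻¹.1 := by
      apply pairAction_reg_injective
      rw [map_mul, map_mul, ← hJ]
      exact LinearMap.ext (Θ.tensorator_ρ σ hσ _ _ a s hs)
    rw [← hs, twistedComul, mul_assoc, ← h, ← mul_assoc, J.mul_inv, one_mul]
    rfl
  · have h := hσ (trivial k H) a (1 : k)
    rw [hΘ, ρ_epsOne] at h
    have h' : (trivial k H).ρ a (1 : k) = Coalgebra.counit (R := k) a • (1 : k) := rfl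
    rw [h'] at h
    have h2 := h.trans (map_smul (Θ.θ (trivial k H)) (Coalgebra.counit (R := k) a) (1 : k))
    exact smul_left_injective k (epsOne_ne_zero F) (h2.trans (congrArg _ hΘ))

end FiberIso

variable [F.Monoidal] [FiniteDimensional k H'] [IsAlgClosed k] [F.Additive] [F.Linear k]
  [Limits.PreservesFiniteLimits F] [Limits.PreservesFiniteColimits F]

/-- The natural isomorphism given by a generator of the image of the regular module. -/
def fiberIsoOfGenerator (hb : IsBasicAlgebra k H) (e : (F.obj (reg k H)).V)
    (he : Function.Surjective (fromReg (F.obj (reg k H)) e).lin) : FiberIso F where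
  θ X := LinearEquiv.ofInjectiveOfFinrankEq
    { toFun := fun x => (F.map (fromReg X x)).lin e
      map_add' := fun x y => by rw [fromReg_add, F.map_add]; rfl
      map_smul' := fun c x => by rw [fromReg_smul, F.map_smul]; rfl }
    (by
      rw [← LinearMap.ker_eq_bot, LinearMap.ker_eq_bot']
      intro x hx
      have hx : (F.map (fromReg X x)).lin e = 0 := hx
      -- As `e` generates `F(H)`, a morphism killing `e` is zero, and faithfulness of `F` gives `x =
      -- 0`. Equality of dimensions then yields bijectivity.
      have := (epi_iff_surjective _).2 he
      have h0 : F.map (fromReg X x) = 0 := by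
        rw [← cancel_epi (fromReg (F.obj (reg k H)) e), fromReg_comp, hx, Limits.comp_zero]
        exact reg_hom_ext (fromReg_one _ _)
      rw [← fromReg_one X x, map_eq_zero F hb h0]
      rfl)
    (finrank_map F hb X).symm
  natural f x := by
    change (F.map f).lin ((F.map (fromReg _ x)).lin e) = (F.map (fromReg _ (f.lin x))).lin e
    rw [← fromReg_comp, F.map_comp]
    rfl

theorem fiberIsoOfGenerator_θ (hb : IsBasicAlgebra k H) (e : (F.obj (reg k H)).V)
    (he : Function.Surjective (fromReg (F.obj (reg k H)) e).lin) :
    (fiberIsoOfGenerator hb e he).θ (reg k H) (regEquiv k H 1) = e := by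
  change (F.map (fromReg _ (regEquiv k H 1))).lin e = e
  rw [fromReg_reg_one, F.map_id]
  rfl

end Gauge

end FinMod

end

theorem mainTheorem3 {k : Type u} [Field k] [IsAlgClosed k]
    {H H' : Type u} [Ring H] [HopfAlgebra k H] [Ring H'] [HopfAlgebra k H']
    [FiniteDimensional k H] [FiniteDimensional k H']
    (hss : ¬ IsSemisimpleRing H) (hss' : ¬ IsSemisimpleRing H')
    (hb : IsBasicAlgebra k H) (hb' : IsBasicAlgebra k H')
    (F : FinMod k H ⥤ FinMod k H') [F.Additive] [F.Linear k] [F.Monoidal]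
    [Limits.PreservesFiniteLimits F] [Limits.PreservesFiniteColimits F]
    (hF : InducesStableEquivalence F) :
    GaugeEquivalent k H H' := by
  obtain ⟨e, he⟩ := FinMod.exists_bijective_fromReg_map_reg hF hb hb' hss'
  let Θ := FinMod.fiberIsoOfGenerator hb e he.2
  obtain ⟨σ, hσ⟩ := Θ.exists_algEquiv (by rwa [FinMod.fiberIsoOfGenerator_θ])
  -- The normalization of `J` needs `θ(1)` to be the unit element of `F`. Both lie on a line, so
  -- rescaling `Θ` by `c` achieves this without changing `σ`.
  let c : k := (Θ.θ (FinMod.trivial k H)).symm (FinMod.epsOne F)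
  have hc' : Θ.θ (FinMod.trivial k H) c = FinMod.epsOne F := LinearEquiv.apply_symm_apply _ _
  have hc : c ≠ 0 := fun h => FinMod.epsOne_ne_zero F (by
    rw [← hc', h]
    exact map_zero _)
  refine (Θ.scale c hc).gaugeEquivalent ?_ σ fun X a x => ?_
  · rw [← hc']
    refine (Θ.scale_θ c hc (FinMod.trivial k H) (1 : k)).trans ?_
    refine (map_smul (Θ.θ (FinMod.trivial k H)) c (1 : k)).symm.trans ?_
    exact congrArg _ (mul_one c)
  · rw [FinMod.FiberIso.scale_θ, FinMod.FiberIso.scale_θ, map_smul, hσ]
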